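/- **Conventions.** A Kreĭn space is a complex space $(\mathcal K,[\cdot,\cdot])$ with an inner product $[\cdot,\cdot]$ (linear in the first variable) for which there are a Hilbert space inner product $\langle\cdot,\cdot\rangle$ on $\mathcal K$ and a bounded operator $J$ on it with $J=J^*=J^{-1}$ and $[\xi,\eta]=\langle J\xi,\eta\rangle$; topological notions refer to the resulting Hilbert space topology, which does not depend on the choice of $J$. A unitary operator between Kreĭn spaces is a bounded, boundedly invertible linear operator $\Phi$ with $[\Phi\xi,\Phi\eta]=[\xi,\eta]$ for all $\xi,\eta$. Let $\mathcal A$ be a unital complex $*$-algebra and $Z:\mathcal A\to\mathbb C$ a linear functional that is hermitian, $Z(a^*)=\overline{Z(a)}$, with $Z(1)=1$. *GNS data* of $Z$ are triples $(\pi,\mathcal K,\Omega)$ consisting of a Kreĭn space $\mathcal K$, a representation $\pi$ of $\mathcal A$ (linear, $\pi(ab)=\pi(a)\pi(b)$) by closable operators defined on a common dense linear domain $\mathcal D(\pi)\subset\mathcal K$ that is invariant under all $\pi(a)$, such that for each $a\in\mathcal A$ the domain of the Kreĭn space adjoint $\pi(a)^\sharp$ contains $\mathcal D(\pi)$ and $\pi(a)^\sharp|_{\mathcal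 D(\pi)}=\pi(a^*)$, and a vector $\Omega\in\mathcal D(\pi)$ such that $Z(a)=[\pi(a)\Omega,\Omega]$ for all $a\in\mathcal A$ and $\mathcal D(\pi)$ is the linear span (without closure) of $\{\pi(a)\Omega: a\in\mathcal A\}$. Two GNS data $(\pi_1,\mathcal K_1,\Omega_1)$ and $(\pi_2,\mathcal K_2,\Omega_2)$ are *unitarily equivalent* if there is a unitary operator $\Phi:\mathcal K_1\to\mathcal K_2$ with $\Phi\mathcal D(\pi_1)=\mathcal D(\pi_2)$, $\pi_2(a)\Phi=\Phi\pi_1(a)$ on $\mathcal D(\pi_1)$ for all $a\in\mathcal A$, and $\Phi\Omega_1=\Omega_2$. A hermitian kernel on $\mathcal A$ is a function $K:\mathcal A\times\mathcal A\to\mathbb C$ with $K(x,y)=\overline{K(y,x)}$. Put $[f,g]_K=\sum_{x,y\in\mathcal A}K(x,y)f(y)\overline{g(x)}$ for finitely supported $f,g:\mathcal A\to\mathbb C$. For hermitian kernels, $K\le K'$ means $[f,f]_K\le[f,f]_{K'}$ for all such $f$, and $L$ is positive definite if it is hermitian and $[f,f]_L\ge0$ for all $f$. Let $K_Z(x,y)=Z(xy^*)$,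 which is a hermitian kernel. If $L$ is positive definite and $-L\le K_Z\le L$, let $\mathcal H_L$ be the Hilbert space completion of the space of finitely supported functions modulo $\{f:[f,f]_L=0\}$ with respect to $[\cdot,\cdot]_L$. The *Gram operator* $A_L$ is the unique bounded operator on $\mathcal H_L$ with $[f,g]_{K_Z}=[A_Lf,g]_L$ for all finitely supported $f,g$ (identified with their classes in $\mathcal H_L$ on the right-hand side); $\rho(A_L)$ denotes its resolvent set. **Theorem.** Let $\mathcal A$ be a unital complex $*$-algebra and let $Z$ be a linear hermitian functional on $\mathcal A$ with $Z(1)=1$ that admits GNS data. The following assertions are equivalent: (1) All GNS data of $Z$ are unitarily equivalent. (2) For each positive definite kernel $L$ on $\mathcal A$ such that $-L\le K_Z\le L$, there exists $\varepsilon>0$ such that either $(0,\varepsilon)\subset\rho(A_L)$ or $(-\varepsilon,0)\subset\rho(A_L)$. -/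

import Mathlib

universe u

open scoped ComplexConjugate

noncomputable section

/-! ### Scalar hermitian kernels -/

namespace HermKernel

variable {X : Type u}

/-- The kernel `K` is hermitian: `K(x,y) = conj K(y,x)`. -/
def IsHermitian (K : X → X → ℂ) : Prop := ∀ x y, K x y = conj (K y x)

/-- The inner product `[f,g]_K = ∑_{x,y} K(x,y) f(y) conj (g(x))` on the space of
finitely supported functions; it is linear in `f` and antilinear in `g`. -/
def form (K : X → X → ℂ) (f g : X →₀ ℂ) : ℂ :=
  f.sum fun y c => g.sum fun x d => K x y * c * conj d

/-- The order on hermitian kernels: `[f,f]_A ≤ [f,f]_B` for all `f` (both numbers are real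
when `A` and `B` are hermitian). -/
def KernelLE (A B : X → X → ℂ) : Prop := ∀ f : X →₀ ℂ, (form A f f).re ≤ (form B f f).re

/-- A hermitian kernel whose inner product is positive. -/
structure IsPosDef (L : X → X → ℂ) : Prop where
  isHermitian : IsHermitian L
  nonneg : ∀ f : X →₀ ℂ, 0 ≤ (form L f f).re

theorem form_add_left (K : X → X → ℂ) (f f' g : X →₀ ℂ) :
    form K (f + f') g = form K f g + form K f' g := by
  classical
  unfold form
  rw [Finsupp.sum_add_index']
  · intro y; simp [Finsupp.sum]
  · intro y b c
    rw [← Finsupp.sum_add]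
    exact Finsupp.sum_congr fun x _ => by ring

theorem form_smul_left (K : X → X → ℂ) (c : ℂ) (f g : X →₀ ℂ) :
    form K (c • f) g = c * form K f g := by
  classical
  unfold form
  rw [Finsupp.sum_smul_index']
  · simp only [Finsupp.sum, Finset.mul_sum, smul_eq_mul]
    exact Finset.sum_congr rfl fun y _ => Finset.sum_congr rfl fun x _ => by ring
  · intro y; simp [Finsupp.sum]

theorem conj_form {K : X → X → ℂ} (hK : IsHermitian K) (f g : X →₀ ℂ) :
    conj (form K f g) = form K g f := by
  unfold form
  simp only [Finsupp.sum, map_sum]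
  rw [Finset.sum_comm]
  refine Finset.sum_congr rfl fun y _ => Finset.sum_congr rfl fun x _ => ?_
  rw [hK y x]
  simp only [map_mul, Complex.conj_conj]
  ring

theorem form_add_right {K : X → X → ℂ} (hK : IsHermitian K) (f g g' : X →₀ ℂ) :
    form K f (g + g') = form K f g + form K f g' := by
  rw [← conj_form hK, form_add_left, map_add, conj_form hK, conj_form hK]

theorem form_smul_right {K : X → X → ℂ} (hK : IsHermitian K) (c : ℂ) (f g : X →₀ ℂ) :
    form K f (c • g) = conj c * form K f g := by
  rw [← conj_form hK, form_smul_left, map_mul, conj_form hK]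

theorem form_neg (K : X → X → ℂ) (f g : X →₀ ℂ) : form (-K) f g = - form K f g := by
  simp [form, Finsupp.sum]

/-! ### The Hilbert space of a positive definite kernel -/

/-- The finitely supported functions on `X`, to be equipped with the positive inner product of
a positive definite kernel `L`. -/
def PreSpace {L : X → X → ℂ} (_hL : IsPosDef L) : Type u := X →₀ ℂ

section

variable {L : X → X → ℂ} (hL : IsPosDef L)

instance : AddCommGroup (PreSpace hL) := inferInstanceAs (AddCommGroup (X →₀ ℂ))

instance : Module ℂ (PreSpace hL) := inferInstanceAs (Module ℂ (X →₀ ℂ))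

/-- Mathlib's inner products are antilinear in the first variable, so `⟪f, g⟫ = [g,f]_L`. -/
@[reducible] def preCore : PreInnerProductSpace.Core ℂ (PreSpace hL) where
  inner f g := form L g f
  conj_inner_symm f g := conj_form hL.isHermitian f g
  re_inner_nonneg f := hL.nonneg f
  add_left f f' g := form_add_right hL.isHermitian g f f'
  smul_left f g c := form_smul_right hL.isHermitian c g f

instance : SeminormedAddCommGroup (PreSpace hL) :=
  @InnerProductSpace.Core.toSeminormedAddCommGroup ℂ (PreSpace hL) _ _ _ (preCore hL)

instance : InnerProductSpace ℂ (PreSpace hL) := InnerProductSpace.ofCore (preCore hL)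

/-- The Hilbert space `H_L`: the completion of the finitely supported functions modulo the
isotropic subspace of `[·,·]_L` (Mathlib's completion of a seminormed space is Hausdorff, hence
it performs the quotient as well). -/
abbrev Space : Type u := UniformSpace.Completion (PreSpace hL)

/-- The class `[f]` in `H_L` of a finitely supported function `f`, as a linear map. -/
def toSpace : (X →₀ ℂ) →ₗ[ℂ] Space hL where
  toFun f := ((show PreSpace hL from f) : Space hL)
  map_add' f g := UniformSpace.Completion.coe_add (α := PreSpace hL) f g
  map_smul' c f := UniformSpace.Completion.coe_smul (X := PreSpace hL) c f

theorem denseRange_toSpace : DenseRange (toSpace hL) :=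
  UniformSpace.Completion.denseRange_coe (α := PreSpace hL)

theorem inner_toSpace (f g : X →₀ ℂ) :
    inner ℂ (toSpace hL g) (toSpace hL f) = form L f g :=
  UniformSpace.Completion.inner_coe (𝕜 := ℂ) (E := PreSpace hL) g f

theorem norm_toSpace_sq (f : X →₀ ℂ) : ‖toSpace hL f‖ ^ 2 = (form L f f).re := by
  rw [← inner_toSpace hL]
  exact (inner_self_eq_norm_sq (𝕜 := ℂ) (toSpace hL f)).symm

end

/-! ### The Gram operator -/

section

variable {K L : X → X → ℂ}

theorem two_re_form_le (hL : IsPosDef L) (hK : IsHermitian K) (h₁ : KernelLE (-L) K) (h₂ : KernelLE K L)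
    (f g : X →₀ ℂ) :
    2 * (form K f g).re ≤ ‖toSpace hL f‖ ^ 2 + ‖toSpace hL g‖ ^ 2 := by
  have a := h₂ (f + g)
  have b := h₁ (f + (-1 : ℂ) • g)
  have s : (form K g f).re = (form K f g).re := by rw [← conj_form hK f g, Complex.conj_re]
  have s' : (form L g f).re = (form L f g).re := by
    rw [← conj_form hL.isHermitian f g, Complex.conj_re]
  rw [form_neg] at b
  simp only [form_add_left, form_add_right hK, form_add_right hL.isHermitian, form_smul_left,
    form_smul_right hK, form_smul_right hL.isHermitian, map_neg, map_one, neg_mul, one_mul,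
    Complex.add_re, Complex.neg_re] at a b
  rw [norm_toSpace_sq, norm_toSpace_sq]
  linarith

theorem norm_form_le (hL : IsPosDef L) (hK : IsHermitian K) (h₁ : KernelLE (-L) K) (h₂ : KernelLE K L)
    (f g : X →₀ ℂ) : ‖form K f g‖ ≤ ‖toSpace hL f‖ * ‖toSpace hL g‖ := by
  -- rotate `f` so that the form becomes real, then scale both arguments
  obtain ⟨w, hw, hwf⟩ : ∃ w : ℂ, ‖w‖ = 1 ∧ w * form K f g = (‖form K f g‖ : ℂ) := by
    by_cases h : form K f g = 0
    · exact ⟨1, by simp, by simp [h]⟩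
    · refine ⟨(‖form K f g‖ : ℂ) / form K f g, ?_, ?_⟩
      · rw [norm_div, Complex.norm_real, norm_norm]
        exact div_self (norm_ne_zero_iff.mpr h)
      · field_simp
  have key : ∀ s t : ℝ, 2 * (s * t * ‖form K f g‖) ≤
      s ^ 2 * ‖toSpace hL f‖ ^ 2 + t ^ 2 * ‖toSpace hL g‖ ^ 2 := by
    intro s t
    have := two_re_form_le hL hK h₁ h₂ (((s : ℂ) * w) • f) ((t : ℂ) • g)
    rw [form_smul_left, form_smul_right hK, map_smul, map_smul, norm_smul, norm_smul, norm_mul,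
      hw, Complex.norm_real, Complex.norm_real, mul_pow, mul_pow, mul_pow, Real.norm_eq_abs,
      Real.norm_eq_abs, sq_abs, sq_abs, Complex.conj_ofReal,
      show (s : ℂ) * w * ((t : ℂ) * form K f g) = ((s * t : ℝ) : ℂ) * (w * form K f g) by
        push_cast; ring, hwf, ← Complex.ofReal_mul, Complex.ofReal_re] at this
    simpa using this
  set a := ‖toSpace hL f‖
  set b := ‖toSpace hL g‖
  set c := ‖form K f g‖
  have ha : 0 ≤ a := norm_nonneg _
  have hb : 0 ≤ b := norm_nonneg _
  have hc : 0 ≤ c := norm_nonneg _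
  rcases ha.eq_or_lt with ha0 | ha0
  · have h := key (b ^ 2 + 1) c
    rw [← ha0] at h ⊢
    by_contra hcon
    have hc' : 0 < c := by
      rw [zero_mul] at hcon; exact not_le.mp hcon
    nlinarith [mul_pos hc' hc', mul_nonneg (mul_nonneg hb hb) (mul_nonneg hc hc)]
  · rcases hb.eq_or_lt with hb0 | hb0
    · have h := key c (a ^ 2 + 1)
      rw [← hb0] at h ⊢
      by_contra hcon
      have hc' : 0 < c := by
        rw [mul_zero] at hcon; exact not_le.mp hcon
      nlinarith [mul_pos hc' hc', mul_nonneg (mul_nonneg ha ha) (mul_nonneg hc hc)]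
    · have h := key b a
      have hab : 0 < a * b := mul_pos ha0 hb0
      by_contra hcon
      rw [not_le] at hcon
      nlinarith [mul_pos hab (sub_pos.mpr hcon)]

/-- Existence and uniqueness of the Gram operator: `[f,g]_K = ⟨A_L [f], [g]⟩_L` (Mathlib's inner
product takes the variable in which it is linear second). -/
theorem existsUnique_gram (hL : IsPosDef L) (hK : IsHermitian K) (h₁ : KernelLE (-L) K) (h₂ : KernelLE K L) :
    ∃! T : Space hL →L[ℂ] Space hL,
      ∀ f g : X →₀ ℂ, form K f g = inner ℂ (toSpace hL g) (T (toSpace hL f)) := by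
  have hd := denseRange_toSpace hL
  have ext_of : ∀ v w : Space hL,
      (∀ g, inner ℂ (toSpace hL g) v = inner ℂ (toSpace hL g) w) → v = w := by
    intro v w h
    refine ext_inner_left ℂ fun z => ?_
    exact hd.induction_on z (isClosed_eq (by fun_prop) (by fun_prop)) h
  -- for each `f`, the Riesz vector of the antilinear functional `g ↦ [f,g]_K`
  have riesz : ∀ f : X →₀ ℂ, ∃ v : Space hL, ‖v‖ ≤ ‖toSpace hL f‖ ∧
      ∀ g, inner ℂ (toSpace hL g) v = form K f g := by
    intro f
    let φ : (X →₀ ℂ) →ₗ[ℂ] ℂ :=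
      { toFun := fun g => form K g f
        map_add' := fun g g' => form_add_left K g g' f
        map_smul' := fun c g => form_smul_left K c g f }
    have hφ : ∀ g, ‖φ g‖ ≤ ‖toSpace hL f‖ * ‖toSpace hL g‖ := fun g => by
      rw [mul_comm]; exact norm_form_le hL hK h₁ h₂ g f
    refine ⟨(InnerProductSpace.toDual ℂ (Space hL)).symm (φ.extendOfNorm (toSpace hL)), ?_, ?_⟩
    · rw [LinearIsometryEquiv.norm_map]
      exact LinearMap.opNorm_extendOfNorm_le hd (norm_nonneg _) hφ
    · intro g
      rw [← inner_conj_symm, InnerProductSpace.toDual_symm_apply,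
        LinearMap.extendOfNorm_eq hd ⟨_, hφ⟩]
      exact conj_form hK g f
  choose v hv hv' using riesz
  let τ : (X →₀ ℂ) →ₗ[ℂ] Space hL :=
    { toFun := v
      map_add' := fun f f' => ext_of _ _ fun g => by
        rw [inner_add_right, hv', hv', hv', form_add_left]
      map_smul' := fun c f => ext_of _ _ fun g => by
        rw [inner_smul_right, hv', hv', form_smul_left, RingHom.id_apply] }
  have hτ : ∀ f, ‖τ f‖ ≤ 1 * ‖toSpace hL f‖ := fun f => by rw [one_mul]; exact hv f
  refine ⟨τ.extendOfNorm (toSpace hL), fun f g => ?_, fun T hT => ?_⟩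
  · rw [LinearMap.extendOfNorm_eq hd ⟨1, hτ⟩]
    exact (hv' f g).symm
  · refine ContinuousLinearMap.ext fun z => ?_
    refine hd.induction_on z (isClosed_eq (by fun_prop) (by fun_prop)) fun f => ?_
    refine ext_of _ _ fun g => ?_
    rw [← hT, LinearMap.extendOfNorm_eq hd ⟨1, hτ⟩]
    exact (hv' f g).symm

/-- The Gram operator `A_L` of the hermitian kernel `K` with respect to the positive definite
kernel `L`, where `-L ≤ K ≤ L`: the bounded operator on `H_L` with `[f,g]_K = ⟨A_L f, g⟩_L`. -/
def gramOperator (hL : IsPosDef L) (hK : IsHermitian K) (h₁ : KernelLE (-L) K) (h₂ : KernelLE K L) :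
    Space hL →L[ℂ] Space hL :=
  (existsUnique_gram hL hK h₁ h₂).choose

theorem gramOperator_spec (hL : IsPosDef L) (hK : IsHermitian K) (h₁ : KernelLE (-L) K) (h₂ : KernelLE K L)
    (f g : X →₀ ℂ) :
    form K f g = inner ℂ (toSpace hL g) (gramOperator hL hK h₁ h₂ (toSpace hL f)) :=
  (existsUnique_gram hL hK h₁ h₂).choose_spec.1 f g

end

end HermKernel

/-! ### Krein spaces -/

/-- A Krein space structure on a complex Hilbert space, given by a fundamental symmetry `J`
(`J = J* = J⁻¹`). The Hilbert space inner product only serves to fix the strong topology;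
the inner product of the Krein space is `KreinStructure.form`. -/
structure KreinStructure (H : Type u) [NormedAddCommGroup H] [InnerProductSpace ℂ H]
    [CompleteSpace H] where
  /-- The fundamental symmetry. -/
  J : H →L[ℂ] H
  isSelfAdjoint : IsSelfAdjoint J
  mul_self : J * J = 1

/-- The indefinite inner product `[x,y] = ⟨J x, y⟩`, linear in `x` and antilinear in `y`. -/
def KreinStructure.form {H : Type u} [NormedAddCommGroup H] [InnerProductSpace ℂ H]
    [CompleteSpace H] (S : KreinStructure H) (x y : H) : ℂ :=
  inner ℂ y (S.J x)

/-! ### GNS data -/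

section GNS

variable {A : Type u} [Ring A] [StarRing A] [Algebra ℂ A]

/-- The linear functional `Z` is hermitian. -/
def IsHermitianFunctional (Z : A →ₗ[ℂ] ℂ) : Prop := ∀ a, Z (star a) = conj (Z a)

/-- The kernel `K_Z(x,y) = Z(x y*)`. -/
def gnsKernel (Z : A →ₗ[ℂ] ℂ) : A → A → ℂ := fun x y => Z (x * star y)

theorem gnsKernel_isHermitian {Z : A →ₗ[ℂ] ℂ} (hZ : IsHermitianFunctional Z) :
    HermKernel.IsHermitian (gnsKernel Z) := by
  intro x y
  rw [gnsKernel, gnsKernel, ← hZ, star_mul, star_star]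

/-- GNS data `(π, K, Ω)` of `Z`: a hermitian closable representation `π` of `A` on a Krein space
`K`, with common invariant dense domain `D`, and a vector `Ω ∈ D` such that
`Z(a) = [π(a)Ω, Ω]` and `D` is the linear span (not its closure) of the vectors `π(a)Ω`. -/
structure GNSData (Z : A →ₗ[ℂ] ℂ) where
  /-- The Krein space. -/
  K : Type u
  [normedAddCommGroup : NormedAddCommGroup K]
  [innerProductSpace : InnerProductSpace ℂ K]
  [completeSpace : CompleteSpace K]
  /-- The Krein space structure. -/
  krein : KreinStructure K
  /-- The common domain of the operators `π(a)`. -/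
  D : Submodule ℂ K
  dense_D : Dense (D : Set K)
  /-- The representation, linear in `a`, by operators leaving the domain invariant. -/
  π : A →ₗ[ℂ] (D →ₗ[ℂ] D)
  map_mul : ∀ a b, π (a * b) = π a ∘ₗ π b
  closable : ∀ a, (LinearPMap.mk D (D.subtype ∘ₗ π a)).IsClosable
  /-- The domain of the Krein space adjoint of `π(a)` contains `D`, and the adjoint coincides
  with `π(a*)` there: for `y ∈ D`, the vector `π(a*) y` is the one that satisfies
  `[π(a) x, y] = [x, π(a*) y]` for all `x ∈ D`. -/
  hermitian : ∀ (a : A) (x y : D), krein.form (π a x) y = krein.form x (π (star a) y)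
  /-- The cyclic vector. -/
  Ω : D
  apply_eq : ∀ a, Z a = krein.form (π a Ω) Ω
  span_eq : Submodule.span ℂ (Set.range fun a => π a Ω) = ⊤

attribute [instance] GNSData.normedAddCommGroup GNSData.innerProductSpace GNSData.completeSpace

/-- Unitary equivalence of GNS data: a unitary operator `Φ : K₁ → K₂` of Krein spaces (that is,
a boundedly invertible operator preserving the indefinite inner products) with `Φ D₁ = D₂`,
`π₂(a) Φ = Φ π₁(a)` on `D₁`, and `Φ Ω₁ = Ω₂`. -/
def GNSData.UnitarilyEquivalent {Z : A →ₗ[ℂ] ℂ} (G₁ G₂ : GNSData Z) : Prop :=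
  ∃ Φ : G₁.K ≃L[ℂ] G₂.K,
    (∀ x y, G₂.krein.form (Φ x) (Φ y) = G₁.krein.form x y) ∧
    Φ '' (G₁.D : Set G₁.K) = (G₂.D : Set G₂.K) ∧
    (∀ (a : A) (x : G₁.D) (y : G₂.D), (y : G₂.K) = Φ x → (G₂.π a y : G₂.K) = Φ (G₁.π a x)) ∧
    Φ G₁.Ω = G₂.Ω

end GNS

end

/-! ### Krein space maps with a one-sided spectral gap -/

section OperatorTheory

open ContinuousLinearMap

variable {H K : Type*} [NormedAddCommGroup H] [InnerProductSpace ℂ H] [CompleteSpace H]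
  [NormedAddCommGroup K] [InnerProductSpace ℂ K] [CompleteSpace K]

/-! GNS data amount to a linear map `V a = π(a)Ω` onto a dense subspace of a Krein space with `[V a,
V b] = Z(b* a)`. The form determines everything except the topology, so two GNS data are unitarily
equivalent exactly when the norms `‖V₁ a‖` and `‖V₂ a‖` are equivalent. The question is whether the
form determines the norm.

Gap implies uniqueness. Given two GNS data, let `L` be the kernel of `‖V₁ a‖² + ‖V₂ a‖²`. Each `V i`
extends to a contraction `W` from `H_L` with dense range and `W* J W = A_L`. If the spectrum of
`A_L` misses `(0, ε)`, the positive spectral projection is `E = R A_L` with `R` bounded, so `W E =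
(W R W* J) W`: the projection descends to a bounded operator on the Krein space. It splits that
space into a positive and a negative part, whence `‖W x‖²` is comparable to `⟨x, |A_L| x⟩`, a
quantity independent of the GNS data (`exists_norm_sq_comparable_abs`). A negative gap follows by
changing signs.

Uniqueness implies gap. If the spectrum of `T = A_L` accumulates at zero from both sides, write `T =
B J B` with `B = |T|^{1/2}` and a symmetry `J`. Localized spectral vectors give orthonormal
sequences `e n`, `e' n` in the range of `B`, with `J = 1` and `J = -1` on them and `‖B (e n)‖`, `‖B
(e' n)‖` at most `4⁻ⁿ`. The unbounded `J`-isometry `1 + i ∑ 2ⁿ [·, v n] v n`, with `v n = e n + e'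
n`, becomes bounded after composition with `B`. The resulting `B'` induces the same form but is not
dominated by `B` (`exists_transvection_not_dominated`), so `B` and `B'` yield inequivalent GNS data.
-/

theorem cfc_comp_apply (A : H →L[ℂ] H) {f g : ℝ → ℝ}
    (hf : Continuous f) (hg : Continuous g) (x : H) :
    cfc f A (cfc g A x) = cfc (fun t => f t * g t) A x := by
  rw [cfc_mul f g A hf.continuousOn hg.continuousOn]
  rfl

theorem inner_cfc_left (A : H →L[ℂ] H) (f : ℝ → ℝ) (x y : H) :
    inner ℂ (cfc f A x) y = inner ℂ x (cfc f A y) := by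
  have h : IsSelfAdjoint (cfc f A) := cfc_predicate f A
  exact (isSelfAdjoint_iff_isSymmetric.mp h) x y

theorem re_inner_cfc_mono (A : H →L[ℂ] H) {f g : ℝ → ℝ}
    (hf : Continuous f) (hg : Continuous g) (h : ∀ t ∈ spectrum ℝ A, f t ≤ g t) (x : H) :
    (inner ℂ x (cfc f A x)).re ≤ (inner ℂ x (cfc g A x)).re := by
  have h1 : cfc f A ≤ cfc g A := cfc_mono h hf.continuousOn hg.continuousOn
  have h2 := (nonneg_iff_isPositive _).mp (sub_nonneg.mpr h1)
  have h3 := h2.re_inner_nonneg_right x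
  rw [sub_apply, inner_sub_right, map_sub] at h3
  exact sub_nonneg.mp h3

theorem norm_cfc_apply_sq (A : H →L[ℂ] H) {f : ℝ → ℝ}
    (hf : Continuous f) (x : H) :
    ‖cfc f A x‖ ^ 2 = (inner ℂ x (cfc (fun t => f t * f t) A x)).re := by
  rw [← cfc_comp_apply A hf hf, ← inner_cfc_left]
  exact (inner_self_eq_norm_sq (𝕜 := ℂ) _).symm

/-- A positive operator satisfies `‖M x‖² ≤ ‖M‖ ⟨x, M x⟩`. -/
theorem norm_apply_sq_le_of_nonneg {M : H →L[ℂ] H} (hM : 0 ≤ M) (x : H) :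
    ‖M x‖ ^ 2 ≤ ‖M‖ * (inner ℂ x (M x)).re := by
  have hs : IsSelfAdjoint M := hM.isSelfAdjoint
  have h1 := norm_cfc_apply_sq M continuous_id x
  have h2 := re_inner_cfc_mono M (f := fun t => id t * id t) (g := fun t => ‖M‖ * t)
    (by fun_prop) (by fun_prop) (fun t ht => ?_) x
  · rw [← h1, cfc_id ℝ M, cfc_const_mul_id ‖M‖ M] at h2
    rw [smul_apply, inner_smul_right_eq_smul] at h2
    simpa using h2
  · have h0 : 0 ≤ t := spectrum_nonneg_of_nonneg hM ht
    have h3 : ‖t‖ ≤ ‖M‖ := (spectrum.norm_le_norm_mul_of_mem ht).trans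
      (mul_le_of_le_one_right (norm_nonneg M) norm_id_le)
    rw [Real.norm_of_nonneg h0] at h3
    exact mul_le_mul_of_nonneg_right h3 h0

theorem norm_apply_of_symmetry {J : K →L[ℂ] K} (hJ : IsSelfAdjoint J) (hJ2 : J * J = 1) (x : K) :
    ‖J x‖ = ‖x‖ := by
  have h : inner ℂ (J x) (J x) = inner ℂ x x := by
    refine ((isSelfAdjoint_iff_isSymmetric.mp hJ) x (J x)).trans ?_
    congr 1
    exact DFunLike.congr_fun hJ2 x
  rw [@norm_eq_sqrt_re_inner ℂ, @norm_eq_sqrt_re_inner ℂ, h]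

/-- Let `W : H → K` have dense range in a Krein space with fundamental symmetry `J`, and let
`A = W* J W`. If `A` has a positive spectral gap at zero, then `‖W x‖²` is comparable to
`⟨x, |A| x⟩`. -/
theorem exists_norm_sq_comparable_abs {A : H →L[ℂ] H} (hA : IsSelfAdjoint A) {J : K →L[ℂ] K}
    (hJ : IsSelfAdjoint J) (hJ2 : J * J = 1) {W : H →L[ℂ] K} (hW : DenseRange W)
    (hWA : ∀ x y, inner ℂ (W y) (J (W x)) = inner ℂ y (A x)) {ε : ℝ} (hε : 0 < ε)
    (hgap : ∀ t ∈ Set.Ioo 0 ε, t ∉ spectrum ℝ A) :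
    ∃ C : ℝ, 0 ≤ C ∧ ∀ x, ‖W x‖ ^ 2 ≤ C * (inner ℂ x (cfc (fun t : ℝ => |t|) A x)).re ∧
      (inner ℂ x (cfc (fun t : ℝ => |t|) A x)).re ≤ C * ‖W x‖ ^ 2 := by
  -- Because of the gap, the continuous function `e` takes only the values 0 and 1 on the spectrum,
  -- so `E` is the spectral projection onto the positive part. On the spectrum `r t * t = e t`,
  -- which gives `R A = E`.
  set e : ℝ → ℝ := fun t => max 0 (min 1 (t / ε)) with he
  set r : ℝ → ℝ := fun t => e t / max ε t with hr
  have hec : Continuous e := by fun_prop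
  have hrc : Continuous r := by
    refine hec.div (by fun_prop) fun t => ?_
    exact (lt_of_lt_of_le hε (le_max_left _ _)).ne'
  have hcase : ∀ t ∈ spectrum ℝ A, (t ≤ 0 ∧ e t = 0) ∨ (ε ≤ t ∧ e t = 1) := by
    intro t ht
    by_cases h0 : t ≤ 0
    · left
      refine ⟨h0, ?_⟩
      have : t / ε ≤ 0 := div_nonpos_of_nonpos_of_nonneg h0 hε.le
      simp only [he]
      rw [min_eq_right (this.trans zero_le_one), max_eq_left this]
    · right
      have h1 : ε ≤ t := by
        by_contra h
        exact hgap t ⟨not_le.mp h0, not_le.mp h⟩ ht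
      refine ⟨h1, ?_⟩
      have : 1 ≤ t / ε := (one_le_div hε).mpr h1
      simp only [he]
      rw [min_eq_left this, max_eq_right zero_le_one]
  have hid : ∀ x, cfc (fun t : ℝ => t) A x = A x := fun x => by rw [cfc_id' ℝ A]
  set E := cfc e A
  set R := cfc r A
  set p : H → ℝ := fun x => (inner ℂ x (cfc (fun t : ℝ => max t 0) A x)).re
  set n : H → ℝ := fun x => (inner ℂ x (cfc (fun t : ℝ => max (-t) 0) A x)).re
  have hp0 : ∀ x, 0 ≤ p x := fun x => by
    have := re_inner_cfc_mono A (f := fun _ => 0) (g := fun t => max t 0) (by fun_prop)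
      (by fun_prop) (fun t _ => le_max_right _ _) x
    simpa [cfc_const_zero] using this
  have hn0 : ∀ x, 0 ≤ n x := fun x => by
    have := re_inner_cfc_mono A (f := fun _ => 0) (g := fun t => max (-t) 0) (by fun_prop)
      (by fun_prop) (fun t _ => le_max_right _ _) x
    simpa [cfc_const_zero] using this
  have hpn : ∀ x, (inner ℂ x (cfc (fun t : ℝ => |t|) A x)).re = p x + n x := fun x => by
    have : cfc (fun t : ℝ => |t|) A
        = cfc (fun t : ℝ => max t 0) A + cfc (fun t : ℝ => max (-t) 0) A := by
      rw [← cfc_add (a := A) (fun t : ℝ => max t 0) (fun t : ℝ => max (-t) 0)]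
      refine cfc_congr fun t _ => ?_
      rcases le_total 0 t with h | h
      · simp [abs_of_nonneg h, h]
      · simp [abs_of_nonpos h, h]
    rw [this, add_apply, inner_add_right, Complex.add_re]
  have hRA : ∀ x, R (A x) = E x := fun x => by
    rw [← hid x, cfc_comp_apply A hrc continuous_id']
    refine DFunLike.congr_fun (cfc_congr fun t ht => ?_) x
    rcases hcase t ht with ⟨_, h⟩ | ⟨h1, h⟩
    · simp [hr, h]
    · have : 0 < t := hε.trans_le h1
      simp only [hr, h, max_eq_right h1]
      field_simp
  have hadj : ∀ x, adjoint W (J (W x)) = A x := fun x => by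
    refine ext_inner_left ℂ fun y => ?_
    rw [adjoint_inner_right, hWA]
  -- `M = -J (1 - Q)` where `Q` is the Krein space projection onto the positive part
  set M : K →L[ℂ] K := J ∘L W ∘L R ∘L adjoint W ∘L J - J with hMdef
  have hMW : ∀ x, M (W x) = J (W (E x)) - J (W x) := fun x => by
    simp [hMdef, hadj, hRA]
  -- On the range of `W`, the form of `M` is that of `A (E - 1)`, the negative part of `A`; by
  -- density this makes `M` positive.
  have hWM : ∀ x, (inner ℂ (W x) (M (W x))).re = n x := fun x => by
    rw [hMW, inner_sub_right, hWA, hWA, ← inner_sub_right]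
    have : A (E x) - A x = cfc (fun t : ℝ => max (-t) 0) A x := by
      rw [← hid (E x), ← hid x, cfc_comp_apply A continuous_id' hec, ← sub_apply,
        ← cfc_sub (a := A) (fun t : ℝ => t * e t) (fun t : ℝ => t)]
      refine DFunLike.congr_fun (cfc_congr fun t ht => ?_) x
      rcases hcase t ht with ⟨h1, h⟩ | ⟨h1, h⟩
      · simp [h, h1]
      · have : 0 ≤ t := hε.le.trans h1
        simp [h, this]
    rw [this]
  have hJs := isSelfAdjoint_iff_isSymmetric.mp hJ
  have hM : 0 ≤ M := by
    rw [nonneg_iff_isPositive, isPositive_def]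
    constructor
    · intro u v
      simp only [hMdef, coe_coe, sub_apply, comp_apply, inner_sub_left, inner_sub_right]
      congr 1
      · have h1 := hJs (W (R (adjoint W (J u)))) v
        have h2 := hJs u (W (R (adjoint W (J v))))
        simp only [coe_coe] at h1 h2
        rw [h1, ← adjoint_inner_right, inner_cfc_left, adjoint_inner_left, h2]
      · exact hJs u v
    · intro u
      refine hW.induction_on u (isClosed_le continuous_const ?_) fun x => ?_
      · exact Complex.continuous_re.comp (by fun_prop)
      · rw [reApplyInnerSelf_apply, inner_re_symm (𝕜 := ℂ)]
        exact (hn0 x).trans_eq (hWM x).symm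
  have hpE : ∀ x, p x = (inner ℂ (W (E x)) (J (W (E x)))).re := fun x => by
    have h : cfc (fun t : ℝ => e t * (t * e t)) A = cfc (fun t : ℝ => max t 0) A := by
      refine cfc_congr fun t ht => ?_
      rcases hcase t ht with ⟨h1, h⟩ | ⟨h1, h⟩
      · simp [h, h1]
      · have : 0 ≤ t := hε.le.trans h1
        simp [h, this]
    rw [hWA, inner_cfc_left, ← hid (E x), cfc_comp_apply A continuous_id' hec,
      cfc_comp_apply A hec (by fun_prop), h]
  have hE : ∀ x, ‖E x‖ ^ 2 ≤ ε⁻¹ * p x := fun x => by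
    rw [norm_cfc_apply_sq A hec]
    have := re_inner_cfc_mono A (f := fun t => e t * e t) (g := fun t => ε⁻¹ * max t 0)
      (by fun_prop) (by fun_prop) (fun t ht => ?_) x
    · rw [cfc_const_mul ε⁻¹ (fun t : ℝ => max t 0) A, smul_apply, inner_smul_right_eq_smul] at this
      simpa using this
    · rcases hcase t ht with ⟨h1, h⟩ | ⟨h1, h⟩
      · simp [h, h1]
      · rw [h, max_eq_left (hε.le.trans h1), mul_one, ← div_eq_inv_mul]
        exact (one_le_div hε).mpr h1
  have hJW : ∀ u : K, (inner ℂ u (J u)).re ≤ ‖u‖ ^ 2 := fun u => by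
    refine (Complex.re_le_norm _).trans ((norm_inner_le_norm _ _).trans_eq ?_)
    rw [norm_apply_of_symmetry hJ hJ2, sq]
  have hMn : ∀ x, ‖M (W x)‖ = ‖W (E x) - W x‖ := fun x => by
    rw [hMW, ← map_sub, norm_apply_of_symmetry hJ hJ2]
  have hM1 : ∀ x, ‖W (E x) - W x‖ ^ 2 ≤ ‖M‖ * n x := fun x => by
    rw [← hMn, ← hWM]
    exact norm_apply_sq_le_of_nonneg hM _
  have hWE : ∀ x, ‖W (E x)‖ ^ 2 ≤ ‖W‖ ^ 2 * (ε⁻¹ * p x) := fun x => by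
    calc ‖W (E x)‖ ^ 2 ≤ (‖W‖ * ‖E x‖) ^ 2 := by gcongr; exact W.le_opNorm _
      _ = ‖W‖ ^ 2 * ‖E x‖ ^ 2 := by ring
      _ ≤ _ := by gcongr; exact hE x
  -- The boundedness of `M` on the Krein space bounds `W (E x)` by `W x`; this is where the descent
  -- of `E` is needed.
  have hpW : ∀ x, p x ≤ (‖M‖ + 1) ^ 2 * ‖W x‖ ^ 2 := fun x => by
    rw [hpE, ← mul_pow]
    refine (hJW _).trans ?_
    gcongr
    calc ‖W (E x)‖ = ‖(W (E x) - W x) + W x‖ := by rw [sub_add_cancel]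
      _ ≤ ‖M (W x)‖ + ‖W x‖ := by rw [hMn]; exact norm_add_le _ _
      _ ≤ ‖M‖ * ‖W x‖ + ‖W x‖ := by gcongr; exact M.le_opNorm _
      _ = _ := by ring
  have hnW : ∀ x, n x ≤ ‖M‖ * ‖W x‖ ^ 2 := fun x => by
    rw [← hWM]
    calc _ ≤ ‖W x‖ * ‖M (W x)‖ := (Complex.re_le_norm _).trans (norm_inner_le_norm _ _)
      _ ≤ ‖W x‖ * (‖M‖ * ‖W x‖) := by gcongr; exact M.le_opNorm _
      _ = _ := by ring
  set c := 2 * (‖W‖ ^ 2 * ε⁻¹) with hc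
  have hc0 : 0 ≤ c := by positivity
  have hm0 := norm_nonneg M
  refine ⟨c + 2 * ‖M‖ + ((‖M‖ + 1) ^ 2 + ‖M‖), by positivity, fun x => ?_⟩
  rw [hpn]
  have hp := hp0 x
  have hn := hn0 x
  constructor
  · have h1 : ‖W x‖ ^ 2 ≤ 2 * ‖W (E x)‖ ^ 2 + 2 * ‖W (E x) - W x‖ ^ 2 := by
      have := parallelogram_law_with_norm ℂ (W (E x)) (W (E x) - W x)
      rw [sub_sub_cancel] at this
      nlinarith [norm_nonneg (W (E x) + (W (E x) - W x))]
    calc ‖W x‖ ^ 2 ≤ c * p x + 2 * ‖M‖ * n x := by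
          have h2 := hWE x
          have h3 := hM1 x
          rw [hc]
          linarith
      _ ≤ (c + 2 * ‖M‖) * (p x + n x) := by
          nlinarith [mul_nonneg hc0 hn, mul_nonneg hm0 hp]
      _ ≤ _ := by
          refine mul_le_mul_of_nonneg_right ?_ (add_nonneg hp hn)
          exact le_add_of_nonneg_right (by positivity)
  · calc p x + n x ≤ ((‖M‖ + 1) ^ 2 + ‖M‖) * ‖W x‖ ^ 2 := by
          rw [add_mul]; exact add_le_add (hpW x) (hnW x)
      _ ≤ _ := by
          refine mul_le_mul_of_nonneg_right ?_ (sq_nonneg _)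
          exact le_add_of_nonneg_left (by positivity)

/-- Changing the signs of `A` and `J` keeps `W` and `|A|` and moves the gap to the positive side. -/
theorem exists_norm_sq_comparable_abs_of_neg {A : H →L[ℂ] H} (hA : IsSelfAdjoint A)
    {J : K →L[ℂ] K} (hJ : IsSelfAdjoint J) (hJ2 : J * J = 1) {W : H →L[ℂ] K} (hW : DenseRange W)
    (hWA : ∀ x y, inner ℂ (W y) (J (W x)) = inner ℂ y (A x)) {ε : ℝ} (hε : 0 < ε)
    (hgap : ∀ t ∈ Set.Ioo (-ε) 0, t ∉ spectrum ℝ A) :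
    ∃ C : ℝ, 0 ≤ C ∧ ∀ x, ‖W x‖ ^ 2 ≤ C * (inner ℂ x (cfc (fun t : ℝ => |t|) A x)).re ∧
      (inner ℂ x (cfc (fun t : ℝ => |t|) A x)).re ≤ C * ‖W x‖ ^ 2 := by
  have h := exists_norm_sq_comparable_abs hA.neg hJ.neg (by simpa using hJ2) hW
    (fun x y => by simp [hWA]) hε (fun t ht h => ?_)
  · have h2 : cfc (fun t : ℝ => |t|) (-A) = cfc (fun t : ℝ => |t|) A := by
      rw [← cfc_comp_neg (fun t : ℝ => |t|) A]
      simp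
    rwa [h2] at h
  · refine hgap (-t) ⟨neg_lt_neg ht.2, neg_lt_zero.mpr ht.1⟩ ?_
    rwa [← spectrum.neg_eq, Set.mem_neg] at h

end OperatorTheory

/-! ### A gap forces uniqueness of the GNS data -/

section GNSUniqueness

variable {A : Type u} [Ring A] [StarRing A] [Algebra ℂ A]

namespace GNSData

variable {Z : A →ₗ[ℂ] ℂ} (G : GNSData Z)

/-- The map `a ↦ π(a) Ω` into the Krein space. -/
noncomputable def vec : A →ₗ[ℂ] G.K := G.D.subtype ∘ₗ LinearMap.applyₗ G.Ω ∘ₗ G.π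

theorem vec_apply (a : A) : G.vec a = G.π a G.Ω := rfl

theorem exists_π_Ω_eq (x : G.D) : ∃ a, G.π a G.Ω = x := by
  have h : LinearMap.range (LinearMap.applyₗ G.Ω ∘ₗ G.π) = ⊤ := by
    rw [← G.span_eq]
    exact ((Submodule.span_eq _).symm.trans rfl)
  exact LinearMap.range_eq_top.mp h x

theorem exists_vec_eq {x : G.K} (hx : x ∈ G.D) : ∃ a, G.vec a = x := by
  obtain ⟨a, ha⟩ := G.exists_π_Ω_eq ⟨x, hx⟩
  exact ⟨a, congrArg Subtype.val ha⟩

theorem vec_mem (a : A) : G.vec a ∈ G.D := (G.π a G.Ω).2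

theorem denseRange_vec : DenseRange G.vec :=
  G.dense_D.mono fun _ hx => G.exists_vec_eq hx

theorem π_apply_of_eq_vec (a : A) {b : A} {x : G.D} (hx : (x : G.K) = G.vec b) :
    (G.π a x : G.K) = G.vec (a * b) := by
  have : x = G.π b G.Ω := Subtype.ext hx
  rw [this, vec_apply, G.map_mul]
  rfl

/-- `π 1` is not assumed to be the identity, but cyclicity gives `Ω = π(b)Ω` for some `b`, and
`π(1)π(b) = π(b)`. -/
theorem vec_one : G.vec 1 = G.Ω := by
  obtain ⟨b, hb⟩ := G.exists_vec_eq G.Ω.2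
  rw [vec_apply, G.π_apply_of_eq_vec 1 hb.symm, one_mul, hb]

theorem form_vec (a b : A) : G.krein.form (G.vec a) (G.vec b) = Z (star b * a) := by
  have h := G.hermitian (star b) (G.π a G.Ω) G.Ω
  rw [star_star] at h
  rw [G.apply_eq, G.map_mul]
  exact h.symm

theorem UnitarilyEquivalent.exists_norm_vec_le {G₁ G₂ : GNSData Z}
    (h : G₁.UnitarilyEquivalent G₂) : ∃ C : ℝ, ∀ a, ‖G₂.vec a‖ ≤ C * ‖G₁.vec a‖ := by
  obtain ⟨Φ, -, -, hπ, hΩ⟩ := h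
  refine ⟨‖(Φ : G₁.K →L[ℂ] G₂.K)‖, fun a => ?_⟩
  have : G₂.vec a = Φ (G₁.vec a) := hπ a G₁.Ω G₂.Ω hΩ.symm
  rw [this]
  exact (Φ : G₁.K →L[ℂ] G₂.K).le_opNorm _

/-- Mutual domination makes `π₁(a)Ω₁ ↦ π₂(a)Ω₂` well defined and bicontinuous. Its extension
preserves the forms because both equal `Z(b* a)` on dense subspaces. -/
theorem unitarilyEquivalent_of_norm_vec_le {G₁ G₂ : GNSData Z}
    (h₁ : ∃ C : ℝ, ∀ a, ‖G₂.vec a‖ ≤ C * ‖G₁.vec a‖)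
    (h₂ : ∃ C : ℝ, ∀ a, ‖G₁.vec a‖ ≤ C * ‖G₂.vec a‖) : G₁.UnitarilyEquivalent G₂ := by
  set Φ : G₁.K ≃L[ℂ] G₂.K :=
    (LinearEquiv.refl ℂ A).extend G₁.vec G₂.vec G₁.denseRange_vec h₁ G₂.denseRange_vec h₂
  have hΦ : ∀ a, Φ (G₁.vec a) = G₂.vec a := fun a =>
    LinearEquiv.extend_eq (LinearEquiv.refl ℂ A) _ _ G₁.denseRange_vec h₁ G₂.denseRange_vec h₂ a
  refine ⟨Φ, fun x y => ?_, ?_, fun a x y hxy => ?_, ?_⟩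
  · refine G₁.denseRange_vec.induction_on x ?_ fun a => ?_
    · refine isClosed_eq ?_ ?_ <;> (try unfold KreinStructure.form) <;> fun_prop
    refine G₁.denseRange_vec.induction_on y ?_ fun b => ?_
    · refine isClosed_eq ?_ ?_ <;> (try unfold KreinStructure.form) <;> fun_prop
    rw [hΦ, hΦ, form_vec, form_vec]
  · ext y
    constructor
    · rintro ⟨x, hx, rfl⟩
      obtain ⟨a, rfl⟩ := G₁.exists_vec_eq hx
      rw [hΦ]
      exact G₂.vec_mem a
    · intro hy
      obtain ⟨a, rfl⟩ := G₂.exists_vec_eq hy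
      exact ⟨G₁.vec a, G₁.vec_mem a, hΦ a⟩
  · obtain ⟨b, hb⟩ := G₁.exists_vec_eq x.2
    rw [← hb, hΦ] at hxy
    rw [G₂.π_apply_of_eq_vec a hxy, G₁.π_apply_of_eq_vec a hb.symm, hΦ]
  · rw [← vec_one, ← vec_one, hΦ]

end GNSData

/-- The linear map `f ↦ ∑ f(y) y*` from finitely supported functions to the algebra. -/
noncomputable def starSum (A : Type u) [Ring A] [StarRing A] [Algebra ℂ A] : (A →₀ ℂ) →ₗ[ℂ] A :=
  Finsupp.linearCombination ℂ star

theorem starSum_single (a : A) : starSum A (Finsupp.single (star a) 1) = a := by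
  simp [starSum]

theorem starSum_surjective : Function.Surjective (starSum A) := fun a => ⟨_, starSum_single a⟩

/-- Since `K_Z(x, y) = Z(x y*)` stars its second argument, summing the starred points transports the
kernel form to `Z(b* a)` on the algebra. -/
theorem form_gnsKernel [StarModule ℂ A] (Z : A →ₗ[ℂ] ℂ) (f g : A →₀ ℂ) :
    HermKernel.form (gnsKernel Z) f g = Z (star (starSum A g) * starSum A f) := by
  simp only [HermKernel.form, starSum, Finsupp.linearCombination_apply, Finsupp.sum, star_sum,
    Finset.sum_mul_sum, map_sum, gnsKernel]
  rw [Finset.sum_comm]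
  refine Finset.sum_congr rfl fun x _ => Finset.sum_congr rfl fun y _ => ?_
  simp only [star_smul, star_star, smul_mul_smul_comm, map_smul, smul_eq_mul, starRingEnd_apply]
  ring

/-- The kernel `(x, y) ↦ ⟨V x*, V y*⟩` attached to a linear map into a Hilbert space. -/
noncomputable def pullbackKernel {K : Type*} [NormedAddCommGroup K] [InnerProductSpace ℂ K]
    (V : A →ₗ[ℂ] K) : A → A → ℂ := fun x y => inner ℂ (V (star x)) (V (star y))

theorem form_pullbackKernel {K : Type*} [NormedAddCommGroup K] [InnerProductSpace ℂ K]
    (V : A →ₗ[ℂ] K) (f g : A →₀ ℂ) :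
    HermKernel.form (pullbackKernel V) f g = inner ℂ (V (starSum A g)) (V (starSum A f)) := by
  simp only [HermKernel.form, starSum, Finsupp.linearCombination_apply, Finsupp.sum, map_sum,
    map_smul, sum_inner, inner_sum, inner_smul_left, inner_smul_right, pullbackKernel,
    Finset.mul_sum]
  refine Finset.sum_congr rfl fun x _ => Finset.sum_congr rfl fun y _ => ?_
  ring

theorem HermKernel.form_add_kernel {X : Type u} (K L : X → X → ℂ) (f g : X →₀ ℂ) :
    HermKernel.form (K + L) f g = HermKernel.form K f g + HermKernel.form L f g := by
  simp [HermKernel.form, Finsupp.sum, add_mul, Finset.sum_add_distrib]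

/-- A self-adjoint operator with a gap at zero in its spectrum determines, up to equivalence,
the Krein space norms that it induces. -/
theorem exists_norm_sq_comparable_abs_of_gap {H K : Type*} [NormedAddCommGroup H]
    [InnerProductSpace ℂ H] [CompleteSpace H] [NormedAddCommGroup K] [InnerProductSpace ℂ K]
    [CompleteSpace K] {T : H →L[ℂ] H} (hT : IsSelfAdjoint T) (S : KreinStructure K)
    {W : H →L[ℂ] K} (hW : DenseRange W) (hWT : ∀ x y, S.form (W x) (W y) = inner ℂ y (T x))
    {ε : ℝ} (hε : 0 < ε)
    (hgap : (∀ t ∈ Set.Ioo (0 : ℝ) ε, (t : ℂ) ∈ resolventSet ℂ T) ∨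
      (∀ t ∈ Set.Ioo (-ε) (0 : ℝ), (t : ℂ) ∈ resolventSet ℂ T)) :
    ∃ C : ℝ, 0 ≤ C ∧ ∀ x, ‖W x‖ ^ 2 ≤ C * (inner ℂ x (cfc (fun t : ℝ => |t|) T x)).re ∧
      (inner ℂ x (cfc (fun t : ℝ => |t|) T x)).re ≤ C * ‖W x‖ ^ 2 := by
  have hs : ∀ t : ℝ, (t : ℂ) ∈ resolventSet ℂ T → t ∉ spectrum ℝ T := fun t ht h => by
    have : (t : ℂ) ∈ spectrum ℂ T := (spectrum.algebraMap_mem_iff ℂ).mpr h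
    exact this ht
  rcases hgap with h | h
  · exact exists_norm_sq_comparable_abs hT S.isSelfAdjoint S.mul_self hW hWT hε
      fun t ht => hs t (h t ht)
  · exact exists_norm_sq_comparable_abs_of_neg hT S.isSelfAdjoint S.mul_self hW hWT hε
      fun t ht => hs t (h t ht)

theorem HermKernel.isSelfAdjoint_gramOperator {X : Type u} {K L : X → X → ℂ}
    (hL : IsPosDef L) (hK : IsHermitian K) (h₁ : KernelLE (-L) K) (h₂ : KernelLE K L) :
    IsSelfAdjoint (gramOperator hL hK h₁ h₂) := by
  rw [ContinuousLinearMap.isSelfAdjoint_iff_isSymmetric]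
  intro x y
  have hd := denseRange_toSpace hL
  refine hd.induction_on x (isClosed_eq (by fun_prop) (by fun_prop)) fun f => ?_
  refine hd.induction_on y (isClosed_eq (by fun_prop) (by fun_prop)) fun g => ?_
  have h := gramOperator_spec hL hK h₁ h₂
  rw [ContinuousLinearMap.coe_coe, ← h, ← inner_conj_symm, ← h, conj_form hK]

theorem abs_re_kreinForm_le {K : Type u} [NormedAddCommGroup K] [InnerProductSpace ℂ K]
    [CompleteSpace K] (S : KreinStructure K) (x : K) : |(S.form x x).re| ≤ ‖x‖ ^ 2 := by
  refine (Complex.abs_re_le_norm _).trans ((norm_inner_le_norm _ _).trans_eq ?_)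
  rw [norm_apply_of_symmetry S.isSelfAdjoint S.mul_self, sq]

variable [StarModule ℂ A]

/-- One kernel `L` dominating both squared norms compares both Krein spaces with the same `|A_L|`.
-/
theorem unitarilyEquivalent_of_gap {Z : A →ₗ[ℂ] ℂ} (hZ : IsHermitianFunctional Z)
    (H : ∀ (L : A → A → ℂ) (hL : HermKernel.IsPosDef L)
      (h₁ : HermKernel.KernelLE (-L) (gnsKernel Z)) (h₂ : HermKernel.KernelLE (gnsKernel Z) L),
      ∃ ε : ℝ, 0 < ε ∧
        ((∀ t ∈ Set.Ioo (0 : ℝ) ε, (t : ℂ) ∈ resolventSet ℂ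
            (HermKernel.gramOperator hL (gnsKernel_isHermitian hZ) h₁ h₂)) ∨
          (∀ t ∈ Set.Ioo (-ε) (0 : ℝ), (t : ℂ) ∈ resolventSet ℂ
            (HermKernel.gramOperator hL (gnsKernel_isHermitian hZ) h₁ h₂))))
    (G₁ G₂ : GNSData Z) : G₁.UnitarilyEquivalent G₂ := by
  set L := pullbackKernel G₁.vec + pullbackKernel G₂.vec with hLdef
  have hform : ∀ f g, HermKernel.form L f g =
      inner ℂ (G₁.vec (starSum A g)) (G₁.vec (starSum A f)) +
        inner ℂ (G₂.vec (starSum A g)) (G₂.vec (starSum A f)) := fun f g => by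
    rw [hLdef, HermKernel.form_add_kernel, form_pullbackKernel, form_pullbackKernel]
  have hre : ∀ f, (HermKernel.form L f f).re =
      ‖G₁.vec (starSum A f)‖ ^ 2 + ‖G₂.vec (starSum A f)‖ ^ 2 := fun f => by
    rw [hform, Complex.add_re]
    congr 1 <;> exact inner_self_eq_norm_sq (𝕜 := ℂ) _
  have hL : HermKernel.IsPosDef L := by
    refine ⟨fun x y => ?_, fun f => ?_⟩
    · simp [hLdef, pullbackKernel, inner_conj_symm]
    · rw [hre]; positivity
  have hK : ∀ f, |(HermKernel.form (gnsKernel Z) f f).re| ≤ (HermKernel.form L f f).re := by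
    intro f
    rw [form_gnsKernel, ← G₁.form_vec, hre]
    exact (abs_re_kreinForm_le _ _).trans (le_add_of_nonneg_right (sq_nonneg _))
  have h₁ : HermKernel.KernelLE (-L) (gnsKernel Z) := fun f => by
    rw [HermKernel.form_neg, Complex.neg_re]
    exact neg_le_of_abs_le (hK f)
  have h₂ : HermKernel.KernelLE (gnsKernel Z) L := fun f => le_of_abs_le (hK f)
  obtain ⟨ε, hε, hgap⟩ := H L hL h₁ h₂
  have hd := HermKernel.denseRange_toSpace hL
  -- The middle quantity `⟨f, |A_L| f⟩` does not involve `G`, so it can be eliminated between `G₁`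
  -- and `G₂`.
  have key : ∀ G : GNSData Z, (∀ f, ‖G.vec (starSum A f)‖ ^ 2 ≤ (HermKernel.form L f f).re) →
      ∃ C : ℝ, 0 ≤ C ∧ ∀ f,
        ‖G.vec (starSum A f)‖ ^ 2 ≤ C * (inner ℂ (HermKernel.toSpace hL f)
          (cfc (fun t : ℝ => |t|) (HermKernel.gramOperator hL (gnsKernel_isHermitian hZ) h₁ h₂)
            (HermKernel.toSpace hL f))).re ∧
        (inner ℂ (HermKernel.toSpace hL f)
          (cfc (fun t : ℝ => |t|) (HermKernel.gramOperator hL (gnsKernel_isHermitian hZ) h₁ h₂)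
            (HermKernel.toSpace hL f))).re ≤ C * ‖G.vec (starSum A f)‖ ^ 2 := by
    intro G hG
    have hb : ∀ f, ‖(G.vec ∘ₗ starSum A) f‖ ≤ 1 * ‖HermKernel.toSpace hL f‖ := fun f => by
      rw [one_mul]
      refine le_of_sq_le_sq ?_ (norm_nonneg _)
      rw [HermKernel.norm_toSpace_sq]
      exact hG f
    set W := (G.vec ∘ₗ starSum A).extendOfNorm (HermKernel.toSpace hL)
    have hWf : ∀ f, W (HermKernel.toSpace hL f) = G.vec (starSum A f) := fun f =>
      LinearMap.extendOfNorm_eq hd ⟨1, hb⟩ f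
    have hW : DenseRange W := by
      refine G.denseRange_vec.mono ?_
      rintro _ ⟨a, rfl⟩
      obtain ⟨f, rfl⟩ := starSum_surjective a
      exact ⟨_, hWf f⟩
    have hWT : ∀ x y, G.krein.form (W x) (W y) = inner ℂ y
        (HermKernel.gramOperator hL (gnsKernel_isHermitian hZ) h₁ h₂ x) := fun x y => by
      refine hd.induction_on x ?_ fun f => ?_
      · refine isClosed_eq ?_ ?_ <;> (try unfold KreinStructure.form) <;> fun_prop
      refine hd.induction_on y ?_ fun g => ?_
      · refine isClosed_eq ?_ ?_ <;> (try unfold KreinStructure.form) <;> fun_prop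
      rw [hWf, hWf, G.form_vec, ← form_gnsKernel, ← HermKernel.gramOperator_spec]
    obtain ⟨C, hC0, hC⟩ := exists_norm_sq_comparable_abs_of_gap
      (HermKernel.isSelfAdjoint_gramOperator hL (gnsKernel_isHermitian hZ) h₁ h₂) G.krein hW
      hWT hε hgap
    refine ⟨C, hC0, fun f => ?_⟩
    rw [← hWf]
    exact hC _
  obtain ⟨C₁, hC₁, hG₁⟩ := key G₁ fun f => by
    rw [hre]; exact le_add_of_nonneg_right (sq_nonneg _)
  obtain ⟨C₂, hC₂, hG₂⟩ := key G₂ fun f => by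
    rw [hre]; exact le_add_of_nonneg_left (sq_nonneg _)
  have bound : ∀ {p q s C D : ℝ}, 0 ≤ C → 0 ≤ D → 0 ≤ p → 0 ≤ q → p ^ 2 ≤ C * s →
      s ≤ D * q ^ 2 → p ≤ Real.sqrt (C * D) * q := by
    intro p q s C D hC hD hp hq h1 h2
    refine le_of_sq_le_sq ?_ (by positivity)
    rw [mul_pow, Real.sq_sqrt (mul_nonneg hC hD), mul_assoc]
    exact h1.trans (mul_le_mul_of_nonneg_left h2 hC)
  refine GNSData.unitarilyEquivalent_of_norm_vec_le ⟨√(C₂ * C₁), fun a => ?_⟩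
    ⟨√(C₁ * C₂), fun a => ?_⟩
  · obtain ⟨f, rfl⟩ := starSum_surjective a
    exact bound hC₂ hC₁ (norm_nonneg _) (norm_nonneg _) (hG₂ f).1 (hG₁ f).2
  · obtain ⟨f, rfl⟩ := starSum_surjective a
    exact bound hC₁ hC₂ (norm_nonneg _) (norm_nonneg _) (hG₁ f).1 (hG₂ f).2

end GNSUniqueness

/-! ### Constructing GNS data from a linear map -/

section GNSConstruction

theorem KreinStructure.eq_zero_of_form_eq_zero {K : Type u} [NormedAddCommGroup K]
    [InnerProductSpace ℂ K] [CompleteSpace K] (S : KreinStructure K) {s : Set K} (hs : Dense s)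
    {x : K} (h : ∀ y ∈ s, S.form x y = 0) : x = 0 := by
  have hJ : S.J x = 0 := hs.eq_zero_of_inner_right ℂ h
  rw [← norm_eq_zero, ← norm_apply_of_symmetry S.isSelfAdjoint S.mul_self, hJ, norm_zero]

variable {A : Type u} [Ring A] [StarRing A] [Algebra ℂ A] {Z : A →ₗ[ℂ] ℂ}

section OfLinearMap

variable {K : Type u} [NormedAddCommGroup K] [InnerProductSpace ℂ K] [CompleteSpace K]
  {S : KreinStructure K} {V : A →ₗ[ℂ] K}

theorem kreinForm_map_mul_left (hform : ∀ a b, S.form (V a) (V b) = Z (star b * a)) (a b c : A) :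
    S.form (V (a * b)) (V c) = S.form (V b) (V (star a * c)) := by
  rw [hform, hform, star_mul, star_star, mul_assoc]

/-- Moving `a` to the test vector as `star a` shows that the form sees `V (a * b)` only through `V
b`; nondegeneracy on a dense subspace does the rest. Left multiplication therefore descends to the
range of `V`. -/
theorem map_mul_eq_of_map_eq (hV : DenseRange V)
    (hform : ∀ a b, S.form (V a) (V b) = Z (star b * a)) (a : A) {b c : A} (h : V b = V c) :
    V (a * b) = V (a * c) := by
  rw [← sub_eq_zero]
  refine S.eq_zero_of_form_eq_zero hV ?_
  rintro _ ⟨d, rfl⟩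
  have h1 : S.form (V (a * b) - V (a * c)) (V d)
      = S.form (V (a * b)) (V d) - S.form (V (a * c)) (V d) := by
    simp [KreinStructure.form]
  rw [h1, kreinForm_map_mul_left hform, kreinForm_map_mul_left hform, h, sub_self]

/-- Left multiplication by `a` as an operator on the range of `V`. -/
noncomputable def leftMulRange (hV : DenseRange V)
    (hform : ∀ a b, S.form (V a) (V b) = Z (star b * a)) :
    A →ₗ[ℂ] (LinearMap.range V →ₗ[ℂ] LinearMap.range V) where
  toFun a :=
    { toFun := fun d => ⟨V (a * d.2.choose), _, rfl⟩
      map_add' := fun d d' => Subtype.ext <| by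
        have h := map_mul_eq_of_map_eq hV hform a (b := (d + d').2.choose)
          (c := d.2.choose + d'.2.choose) (by
            rw [map_add, (d + d').2.choose_spec, d.2.choose_spec, d'.2.choose_spec]; rfl)
        simpa [mul_add] using h
      map_smul' := fun z d => Subtype.ext <| by
        have h := map_mul_eq_of_map_eq hV hform a (b := (z • d).2.choose)
          (c := z • d.2.choose) (by
            rw [map_smul, (z • d).2.choose_spec, d.2.choose_spec]; rfl)
        simpa using h }
  map_add' a b := by ext d; simp [add_mul]
  map_smul' z a := by ext d; simp

theorem leftMulRange_apply (hV : DenseRange V)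
    (hform : ∀ a b, S.form (V a) (V b) = Z (star b * a)) (a : A) {b : A}
    {d : LinearMap.range V} (h : V b = d) : (leftMulRange hV hform a d : K) = V (a * b) :=
  map_mul_eq_of_map_eq hV hform a (d.2.choose_spec.trans h.symm)

/-- The GNS data determined by a linear map of the algebra onto a dense subspace of a Krein
space which induces the form `Z(b* a)`. -/
noncomputable def GNSData.ofLinearMap (S : KreinStructure K) (V : A →ₗ[ℂ] K) (hV : DenseRange V)
    (hform : ∀ a b, S.form (V a) (V b) = Z (star b * a)) : GNSData Z where
  K := K
  krein := S
  D := LinearMap.range V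
  dense_D := hV
  π := leftMulRange hV hform
  map_mul a b := by
    ext d
    obtain ⟨c, hc⟩ := d.2
    have h := leftMulRange_apply hV hform b hc
    rw [LinearMap.comp_apply, leftMulRange_apply hV hform a h.symm,
      leftMulRange_apply hV hform _ hc, mul_assoc]
  closable a := by
    set T : K →ₗ.[ℂ] K := ⟨LinearMap.range V, (LinearMap.range V).subtype ∘ₗ leftMulRange hV hform a⟩
    -- The adjoint relation is a closed condition, so it survives in the closure of the graph. There
    -- a zero first component forces a zero second one by nondegeneracy, which is closability.
    have key : ∀ p ∈ T.graph.topologicalClosure, ∀ c,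
        S.form p.2 (V c) = S.form p.1 (V (star a * c)) := by
      intro p hp c
      have hc : IsClosed {p : K × K | S.form p.2 (V c) = S.form p.1 (V (star a * c))} := by
        refine isClosed_eq ?_ ?_ <;> unfold KreinStructure.form <;> fun_prop
      refine closure_minimal ?_ hc hp
      intro q hq
      obtain ⟨d, h1, h2⟩ := (LinearPMap.mem_graph_iff T).mp hq
      obtain ⟨b, hb⟩ := d.2
      have h3 : q.2 = V (a * b) := h2.symm.trans (leftMulRange_apply hV hform a hb)
      have h4 : q.1 = V b := h1.symm.trans hb.symm
      rw [Set.mem_ofPred_eq, h3, h4]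
      exact kreinForm_map_mul_left hform a b c
    refine ⟨T.graph.topologicalClosure.toLinearPMap, ?_⟩
    rw [Submodule.toLinearPMap_graph_eq]
    intro p hp hp0
    refine S.eq_zero_of_form_eq_zero hV ?_
    rintro _ ⟨c, rfl⟩
    rw [key p hp, hp0]
    simp [KreinStructure.form]
  hermitian a x y := by
    obtain ⟨b, hb⟩ := x.2
    obtain ⟨c, hc⟩ := y.2
    rw [leftMulRange_apply hV hform a hb, leftMulRange_apply hV hform _ hc, ← hb, ← hc]
    exact kreinForm_map_mul_left hform a b c
  Ω := ⟨V 1, LinearMap.mem_range_self V 1⟩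
  apply_eq a := by
    rw [leftMulRange_apply hV hform a (b := 1) rfl, hform, star_one, one_mul, mul_one]
  span_eq := by
    rw [eq_top_iff]
    intro d _
    obtain ⟨b, hb⟩ := d.2
    refine Submodule.subset_span ⟨b, Subtype.ext ?_⟩
    refine (leftMulRange_apply hV hform b (b := 1) rfl).trans ?_
    rw [mul_one, hb]

theorem GNSData.vec_ofLinearMap (S : KreinStructure K) (V : A →ₗ[ℂ] K) (hV : DenseRange V)
    (hform : ∀ a b, S.form (V a) (V b) = Z (star b * a)) (a : A) :
    (GNSData.ofLinearMap S V hV hform).vec a = V a :=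
  (leftMulRange_apply hV hform a (b := 1) rfl).trans (by rw [mul_one])

end OfLinearMap

/-- The Krein space structure on a closed subspace which is invariant under a symmetry. -/
def KreinStructure.ofInvariant {H : Type u} [NormedAddCommGroup H] [InnerProductSpace ℂ H]
    {J : H →L[ℂ] H} (hJ : (J : H →ₗ[ℂ] H).IsSymmetric) (hJ2 : J * J = 1) (M : Submodule ℂ H)
    [CompleteSpace M] (hM : ∀ x ∈ M, J x ∈ M) : KreinStructure M where
  J := (J ∘L M.subtypeL).codRestrict M fun x => hM x x.2
  isSelfAdjoint := by
    rw [ContinuousLinearMap.isSelfAdjoint_iff_isSymmetric]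
    intro x y
    exact hJ (x : H) (y : H)
  mul_self := by
    ext x
    exact DFunLike.congr_fun hJ2 (x : H)

/-- A linear map from the finitely supported functions into a Hilbert space with a symmetry that
leaves the closure of its range invariant, and inducing the form of the kernel `Z(x y*)`,
gives rise to GNS data. -/
theorem exists_gnsData_of_symmetry [StarModule ℂ A] {H : Type u} [NormedAddCommGroup H]
    [InnerProductSpace ℂ H] [CompleteSpace H] {J : H →L[ℂ] H}
    (hJ : (J : H →ₗ[ℂ] H).IsSymmetric) (hJ2 : J * J = 1) (V : (A →₀ ℂ) →ₗ[ℂ] H)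
    (hinv : ∀ x ∈ (LinearMap.range V).topologicalClosure,
      J x ∈ (LinearMap.range V).topologicalClosure)
    (hform : ∀ f g, inner ℂ (V g) (J (V f)) = HermKernel.form (gnsKernel Z) f g) :
    ∃ G : GNSData Z, ∀ f, ‖G.vec (starSum A f)‖ = ‖V f‖ := by
  set M := (LinearMap.range V).topologicalClosure
  have : CompleteSpace M := (Submodule.isClosed_topologicalClosure _).completeSpace_coe
  set S := KreinStructure.ofInvariant hJ hJ2 M hinv
  have hmem : ∀ f, V f ∈ M := fun f => Submodule.le_topologicalClosure _ ⟨f, rfl⟩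
  set V' : (A →₀ ℂ) →ₗ[ℂ] M := V.codRestrict M hmem
  have hform' : ∀ f g, S.form (V' f) (V' g) = HermKernel.form (gnsKernel Z) f g := hform
  have hdense : DenseRange V' := by
    intro x
    rw [closure_subtype]
    have hx : (x : H) ∈ closure (Set.range V) := x.2
    convert hx
    ext y
    constructor
    · rintro ⟨_, ⟨f, rfl⟩, rfl⟩
      exact ⟨f, rfl⟩
    · rintro ⟨f, rfl⟩
      exact ⟨V' f, ⟨f, rfl⟩, rfl⟩
  -- The Hilbert space norm need not factor through the algebra a priori, but the form does, and it
  -- is nondegenerate on the dense range of `V'`.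
  have hker : ∀ f f', starSum A f = starSum A f' → V' f = V' f' := by
    intro f f' h
    rw [← sub_eq_zero]
    refine S.eq_zero_of_form_eq_zero hdense ?_
    rintro _ ⟨g, rfl⟩
    rw [← map_sub, hform', form_gnsKernel, map_sub, h, sub_self, mul_zero, map_zero]
  set V'' : A →ₗ[ℂ] M :=
    { toFun := fun a => V' (Finsupp.single (star a) 1)
      map_add' := fun a b => by
        rw [← map_add]
        exact hker _ _ (by rw [map_add]; simp only [starSum_single])
      map_smul' := fun z a => by
        rw [← map_smul]
        exact hker _ _ (by rw [map_smul]; simp only [starSum_single, RingHom.id_apply]) }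
  have hV'' : ∀ f, V'' (starSum A f) = V' f := fun f => hker _ _ (starSum_single _)
  have hd'' : DenseRange V'' := hdense.mono (by
    rintro _ ⟨f, rfl⟩
    exact ⟨_, hV'' f⟩)
  have hf'' : ∀ a b, S.form (V'' a) (V'' b) = Z (star b * a) := fun a b => by
    refine (hform' _ _).trans ?_
    rw [form_gnsKernel, starSum_single, starSum_single]
  refine ⟨GNSData.ofLinearMap S V'' hd'' hf'', fun f => ?_⟩
  rw [GNSData.vec_ofLinearMap, hV'']
  rfl

end GNSConstruction

/-! ### An unbounded form-preserving perturbation -/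

section UnboundedTransvection

open ContinuousLinearMap

variable {H : Type*} [NormedAddCommGroup H] [InnerProductSpace ℂ H] [CompleteSpace H]

/-- Suppose the range of `B` contains two orthonormal sequences, one positive and one negative for
the symmetry `J`, on which the adjoint of `B` is rapidly decreasing. Composing `B` with an unbounded
product of Krein space transvections along the neutral vectors `e n + e' n` produces a bounded
operator that induces the same form and has the same range up to closure, but whose norm is not
dominated by that of `B`. -/
theorem exists_transvection_not_dominated {J : H →L[ℂ] H} (hJ : (J : H →ₗ[ℂ] H).IsSymmetric)
    {B : H →L[ℂ] H} {e e' x x' : ℕ → H} (he : Orthonormal ℂ e) (he' : Orthonormal ℂ e')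
    (hJe : ∀ n, J (e n) = e n) (hJe' : ∀ n, J (e' n) = - e' n)
    (hx : ∀ n, B (x n) = e n) (hx' : ∀ n, B (x' n) = e' n)
    (hBe : ∀ n, ‖adjoint B (e n)‖ ≤ (1 / 4) ^ n) (hBe' : ∀ n, ‖adjoint B (e' n)‖ ≤ (1 / 4) ^ n) :
    ∃ B' : H →L[ℂ] H, (∀ u v, inner ℂ (B' u) (J (B' v)) = inner ℂ (B u) (J (B v))) ∧
      (LinearMap.range (B' : H →ₗ[ℂ] H))ᗮ = (LinearMap.range (B : H →ₗ[ℂ] H))ᗮ ∧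
      ¬ ∃ C : ℝ, ∀ u, ‖B' u‖ ≤ C * ‖B u‖ := by
  have hJs : ∀ u v, inner ℂ (J u) v = inner ℂ u (J v) := fun u v => hJ u v
  have hee' : ∀ m n, inner ℂ (e m) (e' n) = 0 := fun m n => by
    have h := hJs (e m) (e' n)
    rw [hJe, hJe', inner_neg_right] at h
    exact self_eq_neg.mp h
  have he'e : ∀ m n, inner ℂ (e' m) (e n) = 0 := fun m n => by
    rw [← inner_conj_symm, hee', map_zero]
  have hee := orthonormal_iff_ite.mp he
  have hee2 := orthonormal_iff_ite.mp he'
  set v : ℕ → H := fun n => e n + e' n with hv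
  have hJv : ∀ n, J (v n) = e n - e' n := fun n => by
    rw [hv, map_add, hJe, hJe', sub_eq_add_neg]
  have hvv : ∀ m n, inner ℂ (v m) (J (v n)) = 0 := fun m n => by
    rw [hJv, hv, inner_add_left, inner_sub_right, inner_sub_right, hee, hee2, hee', he'e]
    ring
  -- `⟨w n, u⟩` is the Krein coefficient of `B u` along `v n`. The decay `4⁻ⁿ` of `w n` absorbs the
  -- weight `2ⁿ` in `c`, so the series converges in norm.
  set w : ℕ → H := fun n => adjoint B (J (v n)) with hw
  have hwx : ∀ m u, inner ℂ (w m) u = inner ℂ (e m - e' m) (B u) := fun m u => by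
    rw [hw, adjoint_inner_left, hJv]
  have hvn : ∀ n, ‖v n‖ ≤ 2 := fun n =>
    (norm_add_le _ _).trans (by rw [he.1, he'.1]; norm_num)
  have hwn : ∀ n, ‖w n‖ ≤ 2 * (1 / 4) ^ n := fun n => by
    have h : w n = adjoint B (e n) - adjoint B (e' n) := by rw [← map_sub, ← hJv]
    rw [h]
    refine (norm_sub_le _ _).trans ?_
    linarith [hBe n, hBe' n]
  set c : ℕ → H →L[ℂ] H := fun n => (2 ^ n : ℂ) • InnerProductSpace.rankOne ℂ (v n) (w n) with hc
  have hcs : Summable c := by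
    refine Summable.of_norm_bounded (g := fun n : ℕ => 4 * (1 / 2 : ℝ) ^ n)
      ((summable_geometric_of_lt_one (by norm_num) (by norm_num)).mul_left 4) fun n => ?_
    rw [hc, norm_smul, InnerProductSpace.norm_rankOne, norm_pow, Complex.norm_ofNat]
    calc (2 : ℝ) ^ n * (‖v n‖ * ‖w n‖) ≤ 2 ^ n * (2 * (2 * (1 / 4) ^ n)) := by
          gcongr
          · exact hvn n
          · exact hwn n
      _ = 4 * (2 * (1 / 4)) ^ n := by rw [mul_pow]; ring
      _ = _ := by norm_num
  set C : H →L[ℂ] H := ∑' n, c n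
  have hCs : ∀ u, HasSum (fun n => ((2 ^ n : ℂ) * inner ℂ (w n) u) • v n) (C u) := fun u => by
    have h := (ContinuousLinearMap.apply ℂ H u).hasSum hcs.hasSum
    simpa [hc, mul_smul] using! h
  have hinner : ∀ y u, HasSum (fun n => ((2 ^ n : ℂ) * inner ℂ (w n) u) * inner ℂ y (v n))
      (inner ℂ y (C u)) := fun y u => by
    have h := (innerSL ℂ y).hasSum (hCs u)
    simpa [inner_smul_right] using! h
  have hCx : ∀ n, C (x n) = (2 ^ n : ℂ) • v n := fun n => by
    refine (hCs (x n)).unique ?_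
    convert hasSum_single n fun m hm => ?_ using 1
    · rw [hwx, hx, inner_sub_left, hee, he'e]; simp
    · rw [hwx, hx, inner_sub_left, hee, he'e]; simp [hm]
  have hCx' : ∀ n, C (x' n) = -((2 ^ n : ℂ) • v n) := fun n => by
    refine (hCs (x' n)).unique ?_
    convert hasSum_single n fun m hm => ?_ using 1
    · rw [hwx, hx', inner_sub_left, hee2, hee']; simp
    · rw [hwx, hx', inner_sub_left, hee2, hee']; simp [hm]
  have hvC : ∀ y, (∀ n, inner ℂ y (v n) = 0) → ∀ u, inner ℂ y (C u) = 0 := fun y hy u => by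
    refine (hinner y u).unique ?_
    simp [hy]
  -- The `v n` are neutral and mutually `J`-orthogonal, hence so is everything in the range of `C`.
  have hCC : ∀ u u', inner ℂ (C u) (J (C u')) = 0 := fun u u' => by
    rw [← hJs]
    refine hvC _ (fun n => ?_) u'
    rw [hJs, ← inner_conj_symm, hvC (J (v n)) (fun m => ?_) u, map_zero]
    rw [hJs, hvv]
  have hBC : ∀ u u', inner ℂ (B u) (J (C u')) = inner ℂ (C u) (J (B u')) := fun u u' => by
    rw [← hJs, ← inner_conj_symm (C u)]
    refine (hinner (J (B u)) u').unique ?_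
    convert (hinner (J (B u')) u).star using 1
    · funext n
      have h : ∀ a, inner ℂ (J (B a)) (v n) = inner ℂ a (w n) := fun a => by
        rw [hJs, hw, adjoint_inner_right]
      rw [h, h, star_mul', star_mul', star_pow]
      simp only [RCLike.star_def, inner_conj_symm, map_ofNat]
      ring
    · rfl
  -- The cross terms agree by `hBC`; the factor `I` gives them opposite signs, so they cancel.
  refine ⟨B + Complex.I • C, fun u u' => ?_, ?_, ?_⟩
  · simp only [add_apply, smul_apply, map_add, map_smul, inner_add_left, inner_add_right,
      inner_smul_left, inner_smul_right, hCC, hBC, Complex.conj_I]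
    ring
  · have hxv : ∀ n, (B + Complex.I • C) (x n + x' n) = v n := fun n => by
      simp [hx, hx', hCx, hCx', hv]
    have hxv' : ∀ n, B (x n + x' n) = v n := fun n => by
      simp [hx, hx', hv]
    ext y
    simp only [Submodule.mem_orthogonal', LinearMap.mem_range, forall_exists_index,
      forall_apply_eq_imp_iff, coe_coe]
    constructor
    · intro h u
      have h1 := hvC y (fun n => by rw [← hxv]; exact h _) u
      have h2 := h u
      rw [add_apply, smul_apply, inner_add_right, inner_smul_right, h1, mul_zero, add_zero] at h2
      exact h2
    · intro h u
      have h1 := hvC y (fun n => by rw [← hxv']; exact h _) u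
      rw [add_apply, smul_apply, inner_add_right, inner_smul_right, h1, mul_zero, add_zero, h]
  · rintro ⟨D, hD⟩
    obtain ⟨n, hn⟩ := pow_unbounded_of_one_lt D (one_lt_two (α := ℝ))
    have h1 := hD (x n)
    rw [hx, he.1, mul_one] at h1
    have h2 : inner ℂ (e' n) ((B + Complex.I • C) (x n)) = Complex.I * 2 ^ n := by
      simp [hx, hCx, hv, he'e, he'.1]
    have h3 := norm_inner_le_norm (𝕜 := ℂ) (e' n) ((B + Complex.I • C) (x n))
    rw [h2, he'.1, one_mul, norm_mul, Complex.norm_I, one_mul, norm_pow, Complex.norm_ofNat] at h3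
    linarith

end UnboundedTransvection

/-! ### Localized spectral vectors and polar decomposition -/

section SpectralSequences

open ContinuousLinearMap

variable {H : Type*} [NormedAddCommGroup H] [InnerProductSpace ℂ H] [CompleteSpace H]

/-- A continuous function with peak `1` at `p`, supported in `[p/2, 3p/2]`. -/
noncomputable def bump (p t : ℝ) : ℝ := max 0 (1 - 2 * |t - p| / p)

theorem continuous_bump (p : ℝ) : Continuous (bump p) := by
  unfold bump
  fun_prop

theorem bump_self (p : ℝ) : bump p p = 1 := by simp [bump]

theorem bump_eq_zero_of_le {p t : ℝ} (hp : 0 < p) (h : t ≤ p / 2) : bump p t = 0 := by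
  refine max_eq_left ?_
  rw [sub_nonpos, le_div_iff₀ hp]
  linarith [neg_abs_le (t - p)]

theorem bump_eq_zero_of_ge {p t : ℝ} (hp : 0 < p) (h : 3 / 2 * p ≤ t) : bump p t = 0 := by
  refine max_eq_left ?_
  rw [sub_nonpos, le_div_iff₀ hp]
  linarith [le_abs_self (t - p)]

theorem bump_mul_bump {p q : ℝ} (hp : 0 < p) (hq : 0 < q) (h : q ≤ p / 3) (t : ℝ) :
    bump p t * bump q t = 0 := by
  rcases le_total t (p / 2) with ht | ht
  · rw [bump_eq_zero_of_le hp ht, zero_mul]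
  · rw [bump_eq_zero_of_ge hq (by linarith), mul_zero]

/-- A unit vector that is spectrally localized near a positive spectral value. -/
theorem exists_localized_unit_vector {T : H →L[ℂ] H} (hT : IsSelfAdjoint T) {p : ℝ} (hp : 0 < p)
    (hpT : p ∈ spectrum ℝ T) :
    ∃ e x u : H, ‖e‖ = 1 ∧ cfc (bump p) T u = e ∧ cfc (fun t : ℝ => √|t|) T x = e ∧
      cfc (fun t : ℝ => √(max t 0)) T x = e ∧
      ‖cfc (fun t : ℝ => √|t|) T e‖ ≤ √(3 / 2 * p) := by
  have hg := continuous_bump p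
  have hG : cfc (bump p) T ≠ 0 := by
    intro h
    have := norm_apply_le_norm_cfc (bump p) T hpT hg.continuousOn hT
    rw [h, bump_self, norm_zero, norm_one] at this
    linarith
  obtain ⟨u₀, hu₀⟩ : ∃ u, cfc (bump p) T u ≠ 0 := by
    by_contra! h
    exact hG (ContinuousLinearMap.ext h)
  set r : ℂ := ((‖cfc (bump p) T u₀‖⁻¹ : ℝ) : ℂ)
  set u := r • u₀
  set e := cfc (bump p) T u with he
  have hen : ‖e‖ = 1 := by
    rw [he, map_smul, norm_smul, Complex.norm_real, norm_inv, norm_norm,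
      inv_mul_cancel₀ (norm_ne_zero_iff.mpr hu₀)]
  -- The bump vanishes for `t ≤ p / 2`, so this is a continuous version of `bump p t / √t`. One
  -- preimage then serves both `√|t|` and `√(max t 0)`.
  set k : ℝ → ℝ := fun t => bump p t / √(max (p / 2) t) with hk
  have hpos : ∀ t, 0 < √(max (p / 2) t) := fun t =>
    Real.sqrt_pos.mpr (lt_of_lt_of_le (half_pos hp) (le_max_left _ _))
  have hkc : Continuous k := hg.div (by fun_prop) fun t => (hpos t).ne'
  have hkey : ∀ s : ℝ → ℝ, Continuous s → (∀ t, 0 < t → s t = √t) →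
      cfc s T (cfc k T u) = e := by
    intro s hs hst
    rw [cfc_comp_apply T hs hkc, he]
    have : (fun t => s t * k t) = bump p := by
      funext t
      rcases le_total t (p / 2) with ht | ht
      · simp [hk, bump_eq_zero_of_le hp ht]
      · have ht0 : 0 < t := (half_pos hp).trans_le ht
        have := hpos t
        rw [max_eq_right ht] at this
        simp only [hk, hst t ht0, max_eq_right ht]
        field_simp
    rw [this]
  refine ⟨e, cfc k T u, u, hen, rfl, hkey _ (by fun_prop) fun t ht => by rw [abs_of_pos ht],
    hkey _ (by fun_prop) fun t ht => by rw [max_eq_left ht.le], ?_⟩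
  -- On the support of the bump this truncation equals `√|t|`, and its supremum gives the norm
  -- bound.
  set h : ℝ → ℝ := fun t => min √|t| √(3 / 2 * p) with hh
  have hhc : Continuous h := by fun_prop
  have h1 : cfc (fun t : ℝ => √|t|) T e = cfc h T e := by
    rw [he, cfc_comp_apply T (by fun_prop) hg, cfc_comp_apply T hhc hg]
    have : (fun t : ℝ => √|t| * bump p t) = fun t => h t * bump p t := by
      funext t
      rcases le_total (3 / 2 * p) t with ht | ht
      · rw [bump_eq_zero_of_ge hp ht, mul_zero, mul_zero]
      rcases le_total t (p / 2) with ht' | ht'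
      · rw [bump_eq_zero_of_le hp ht', mul_zero, mul_zero]
      have ht0 : 0 < t := (half_pos hp).trans_le ht'
      simp only [hh]
      rw [min_eq_left (Real.sqrt_le_sqrt (by rwa [abs_of_pos ht0]))]
    rw [this]
  rw [h1]
  have h2 : ‖cfc h T‖ ≤ √(3 / 2 * p) := norm_cfc_le (Real.sqrt_nonneg _) fun t _ => by
    rw [Real.norm_of_nonneg (le_min (Real.sqrt_nonneg _) (Real.sqrt_nonneg _))]
    exact min_le_right _ _
  calc ‖cfc h T e‖ ≤ ‖cfc h T‖ * ‖e‖ := le_opNorm _ _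
    _ ≤ _ := by rw [hen, mul_one]; exact h2

theorem exists_rapidly_decreasing_seq {s : Set ℝ}
    (hs : ∀ ε : ℝ, 0 < ε → ∃ t ∈ Set.Ioo 0 ε, t ∈ s) :
    ∃ p : ℕ → ℝ, (∀ n, 0 < p n) ∧ (∀ n, p n ∈ s) ∧ (∀ m n, m < n → p n ≤ p m / 3) ∧
      ∀ n, √(3 / 2 * p n) ≤ (1 / 4) ^ n := by
  choose! f hf hfs using hs
  -- `48 = 3 * 16`: a ratio of 3 already makes the bump supports essentially disjoint, and 16 makes
  -- the square roots decay like `4⁻ⁿ`; starting below `1/2` absorbs the factor `3/2`.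
  let p : ℕ → ℝ := fun n => Nat.rec (f (1 / 2)) (fun _ q => f (q / 48)) n
  have hp : ∀ n, 0 < p n ∧ p n ∈ s := by
    intro n
    induction n with
    | zero => exact ⟨(hf _ (by norm_num)).1, hfs _ (by norm_num)⟩
    | succ n ih => exact ⟨(hf (p n / 48) (by linarith [ih.1])).1, hfs _ (by linarith [ih.1])⟩
  have hstep : ∀ n, p (n + 1) ≤ p n / 48 := fun n =>
    (hf (p n / 48) (by linarith [(hp n).1])).2.le
  have hanti : Antitone p := antitone_nat_of_succ_le fun n => by
    linarith [hstep n, (hp n).1]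
  refine ⟨p, fun n => (hp n).1, fun n => (hp n).2, fun m n hmn => ?_, fun n => ?_⟩
  · linarith [hanti (Nat.succ_le_of_lt hmn), hstep m, (hp m).1]
  · refine Real.sqrt_le_iff.mpr ⟨by positivity, ?_⟩
    have h : ∀ n, 3 / 2 * p n ≤ (1 / 16) ^ n := by
      intro n
      induction n with
      | zero =>
        have : p 0 < 1 / 2 := (hf _ (by norm_num)).2
        linarith
      | succ n ih =>
        rw [pow_succ]
        linarith [hstep n, (hp n).1]
    refine (h n).trans_eq ?_
    rw [← pow_mul, mul_comm, pow_mul]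
    norm_num

/-- Bumps at well separated spectral values have product zero, so the localized vectors are
orthogonal. -/
theorem exists_orthonormal_localized_seq {T : H →L[ℂ] H} (hT : IsSelfAdjoint T)
    (hs : ∀ ε : ℝ, 0 < ε → ∃ t ∈ Set.Ioo 0 ε, t ∈ spectrum ℝ T) :
    ∃ e x : ℕ → H, Orthonormal ℂ e ∧ (∀ n, cfc (fun t : ℝ => √|t|) T (x n) = e n) ∧
      (∀ n, cfc (fun t : ℝ => √(max t 0)) T (x n) = e n) ∧
      ∀ n, ‖cfc (fun t : ℝ => √|t|) T (e n)‖ ≤ (1 / 4) ^ n := by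
  obtain ⟨p, hp0, hps, hp3, hp4⟩ := exists_rapidly_decreasing_seq hs
  choose e x u hen hu hx hx' hB using fun n => exists_localized_unit_vector hT (hp0 n) (hps n)
  refine ⟨e, x, ⟨hen, ?_⟩, hx, hx', fun n => (hB n).trans (hp4 n)⟩
  have key : ∀ m n, m < n → inner ℂ (e m) (e n) = 0 := fun m n hmn => by
    rw [← hu m, ← hu n, inner_cfc_left, cfc_comp_apply T (continuous_bump _) (continuous_bump _)]
    simp [bump_mul_bump (hp0 m) (hp0 n) (hp3 m n hmn), cfc_const_zero]
  intro m n hmn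
  rcases lt_or_gt_of_ne hmn with h | h
  · exact key m n h
  · rw [← inner_conj_symm, key n m h, map_zero]

theorem exists_orthonormal_localized_seq_of_neg {T : H →L[ℂ] H} (hT : IsSelfAdjoint T)
    (hs : ∀ ε : ℝ, 0 < ε → ∃ t ∈ Set.Ioo (-ε) 0, t ∈ spectrum ℝ T) :
    ∃ e x : ℕ → H, Orthonormal ℂ e ∧ (∀ n, cfc (fun t : ℝ => √|t|) T (x n) = e n) ∧
      (∀ n, cfc (fun t : ℝ => √(max (-t) 0)) T (x n) = e n) ∧
      ∀ n, ‖cfc (fun t : ℝ => √|t|) T (e n)‖ ≤ (1 / 4) ^ n := by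
  have h := exists_orthonormal_localized_seq hT.neg fun ε hε => by
    obtain ⟨t, ht, hts⟩ := hs ε hε
    refine ⟨-t, ⟨neg_pos.mpr ht.2, neg_lt.mp ht.1⟩, ?_⟩
    rwa [← spectrum.neg_eq, Set.mem_neg, neg_neg]
  rw [← cfc_comp_neg (fun t : ℝ => √|t|) T, ← cfc_comp_neg (fun t : ℝ => √(max t 0)) T] at h
  simpa only [abs_neg] using h

/-- The polar decomposition of a self-adjoint operator `T`, in the form of a symmetry `J` for
which `|T|^{1/2} J |T|^{1/2} = T`. -/
theorem exists_symmetry_of_isSelfAdjoint {T : H →L[ℂ] H} (hT : IsSelfAdjoint T) :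
    ∃ J : H →L[ℂ] H, (J : H →ₗ[ℂ] H).IsSymmetric ∧ J * J = 1 ∧
      (∀ x, J (cfc (fun t : ℝ => √(max t 0)) T x) = cfc (fun t : ℝ => √(max t 0)) T x) ∧
      (∀ x, J (cfc (fun t : ℝ => √(max (-t) 0)) T x) = -cfc (fun t : ℝ => √(max (-t) 0)) T x) ∧
      (∀ x y, inner ℂ (cfc (fun t : ℝ => √|t|) T y) (J (cfc (fun t : ℝ => √|t|) T x)) =
        inner ℂ y (T x)) ∧
      ∀ x ∈ (LinearMap.range ((cfc (fun t : ℝ => √|t|) T : H →L[ℂ] H) : H →ₗ[ℂ] H)).topologicalClosure,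
        J x ∈ (LinearMap.range ((cfc (fun t : ℝ => √|t|) T : H →L[ℂ] H) : H →ₗ[ℂ] H)).topologicalClosure := by
  set P := cfc (fun t : ℝ => √(max t 0)) T with hP
  set N := cfc (fun t : ℝ => √(max (-t) 0)) T with hN
  set B := cfc (fun t : ℝ => √|t|) T with hB
  set M := (LinearMap.range (P : H →ₗ[ℂ] H)).topologicalClosure
  have : CompleteSpace M := (Submodule.isClosed_topologicalClosure _).completeSpace_coe
  -- `P` and `N` are the square roots of the positive and negative parts of `T`. The reflection in
  -- the closed range of `P` is 1 on it and -1 on its complement, which contains the range of `N`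
  -- and the kernel of `T`.
  set J : H →L[ℂ] H := (M.reflection : H →L[ℂ] H)
  have hJP : ∀ x, J (P x) = P x := fun x =>
    Submodule.reflection_mem_subspace_eq_self (Submodule.le_topologicalClosure _ ⟨x, rfl⟩)
  have hPN : ∀ t : ℝ, √(max t 0) * √(max (-t) 0) = 0 := fun t => by
    rcases le_total 0 t with h | h <;> simp [h]
  have hsum : ∀ t : ℝ, √|t| = √(max t 0) + √(max (-t) 0) := fun t => by
    rcases le_total 0 t with h | h
    · simp [h, abs_of_nonneg h]
    · simp [h, abs_of_nonpos h]
  have hJN : ∀ x, J (N x) = - N x := fun x => by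
    refine Submodule.reflection_mem_subspace_orthogonalComplement_eq_neg ?_
    rw [Submodule.orthogonal_closure, Submodule.mem_orthogonal]
    rintro _ ⟨y, rfl⟩
    rw [coe_coe, hP, inner_cfc_left, hN, cfc_comp_apply T (by fun_prop) (by fun_prop)]
    simp [hPN, cfc_const_zero]
  have hBPN : ∀ x, B x = P x + N x := fun x => by
    rw [hB, hP, hN, ← add_apply, ← cfc_add (a := T) (fun t : ℝ => √(max t 0))
      (fun t : ℝ => √(max (-t) 0))]
    simp only [hsum]
  have hJB : ∀ x, J (B x) = P x - N x := fun x => by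
    rw [hBPN, map_add, hJP, hJN, sub_eq_add_neg]
  have hJs : (J : H →ₗ[ℂ] H).IsSymmetric := fun x y => by
    have h := M.reflection.inner_map_map x (M.reflection y)
    rw [Submodule.reflection_reflection] at h
    exact h
  refine ⟨J, hJs, ?_, hJP, hJN, fun x y => ?_, fun x hx => ?_⟩
  · ext x
    exact Submodule.reflection_reflection M x
  · have h : (fun t : ℝ => √|t| * (√(max t 0) - √(max (-t) 0))) = fun t => t := by
      funext t
      rcases le_total 0 t with h | h
      · simp [h, abs_of_nonneg h]
      · simp [h, abs_of_nonpos h]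
    rw [hJB, hB, inner_cfc_left, hP, hN, ← sub_apply, ← cfc_sub (a := T)
      (fun t : ℝ => √(max t 0)) (fun t : ℝ => √(max (-t) 0)),
      cfc_comp_apply T (by fun_prop) (by fun_prop), h, cfc_id' ℝ T]
  -- As `J` is symmetric, it suffices that it preserves the orthogonal complement of the range of
  -- `B`. There `B y = 0`, which forces `P y = N y = 0` since `P` and `N` are dominated by `B`.
  · rw [← Submodule.orthogonal_orthogonal_eq_closure] at hx ⊢
    rw [Submodule.mem_orthogonal]
    intro y hy
    have hBy : B y = 0 := by
      refine ext_inner_left ℂ fun z => ?_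
      rw [← inner_cfc_left, inner_zero_right]
      exact (Submodule.mem_orthogonal _ _).mp hy _ ⟨z, rfl⟩
    have hzero : ∀ f : ℝ → ℝ, Continuous f → (∀ t, f t * f t ≤ √|t| * √|t|) →
        cfc f T y = 0 := fun f hf h => by
      have h1 := re_inner_cfc_mono T (hf.mul hf) (g := fun t => √|t| * √|t|) (by fun_prop)
        (fun t _ => h t) y
      have h2 := norm_cfc_apply_sq T hf y
      have h3 := norm_cfc_apply_sq T (f := fun t => √|t|) (by fun_prop) y
      rw [← hB, hBy, norm_zero] at h3
      have h4 : ‖cfc f T y‖ ^ 2 ≤ 0 := by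
        rw [h2]
        refine h1.trans ?_
        rw [← h3]
        norm_num
      exact norm_eq_zero.mp (pow_eq_zero_iff two_ne_zero |>.mp (le_antisymm h4 (sq_nonneg _)))
    have hPy : P y = 0 := hzero _ (by fun_prop) fun t =>
      mul_self_le_mul_self (Real.sqrt_nonneg _)
        (by rw [hsum]; exact le_add_of_nonneg_right (Real.sqrt_nonneg _))
    have hNy : N y = 0 := hzero _ (by fun_prop) fun t =>
      mul_self_le_mul_self (Real.sqrt_nonneg _)
        (by rw [hsum]; exact le_add_of_nonneg_left (Real.sqrt_nonneg _))
    have hJy : J y ∈ (LinearMap.range (B : H →ₗ[ℂ] H))ᗮ := by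
      rw [Submodule.mem_orthogonal']
      rintro _ ⟨z, rfl⟩
      refine (hJs y (B z)).trans ?_
      rw [coe_coe, hJB, inner_sub_right, hP, hN, ← inner_cfc_left, ← inner_cfc_left, ← hP, ← hN,
        hPy, hNy]
      simp
    refine (hJs y x).symm.trans ?_
    exact (Submodule.mem_orthogonal _ _).mp hx _ hJy

end SpectralSequences

/-! ### Two-sided accumulation destroys uniqueness -/

section GNSNonuniqueness

theorem orthogonal_range_comp_of_denseRange {E H K : Type*} [AddCommGroup E] [Module ℂ E]
    [NormedAddCommGroup H] [InnerProductSpace ℂ H] [NormedAddCommGroup K] [InnerProductSpace ℂ K]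
    (B : H →L[ℂ] K) {ι : E →ₗ[ℂ] H} (hι : DenseRange ι) :
    (LinearMap.range ((B : H →ₗ[ℂ] K) ∘ₗ ι))ᗮ = (LinearMap.range (B : H →ₗ[ℂ] K))ᗮ := by
  refine le_antisymm (fun y hy => ?_)
    (Submodule.orthogonal_le (LinearMap.range_comp_le_range ι (B : H →ₗ[ℂ] K)))
  rw [Submodule.mem_orthogonal] at hy ⊢
  rintro _ ⟨x, rfl⟩
  refine hι.induction_on x (isClosed_eq ?_ continuous_const) fun f => hy _ ⟨f, rfl⟩
  simp only [ContinuousLinearMap.coe_coe]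
  fun_prop

variable {A : Type u} [Ring A] [StarRing A] [Algebra ℂ A] [StarModule ℂ A]

theorem exists_gap_of_unitarilyEquivalent {Z : A →ₗ[ℂ] ℂ} (hZ : IsHermitianFunctional Z)
    (H : ∀ G₁ G₂ : GNSData Z, G₁.UnitarilyEquivalent G₂)
    {L : A → A → ℂ} (hL : HermKernel.IsPosDef L)
    (h₁ : HermKernel.KernelLE (-L) (gnsKernel Z)) (h₂ : HermKernel.KernelLE (gnsKernel Z) L) :
    ∃ ε : ℝ, 0 < ε ∧
      ((∀ t ∈ Set.Ioo (0 : ℝ) ε, (t : ℂ) ∈ resolventSet ℂ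
          (HermKernel.gramOperator hL (gnsKernel_isHermitian hZ) h₁ h₂)) ∨
        (∀ t ∈ Set.Ioo (-ε) (0 : ℝ), (t : ℂ) ∈ resolventSet ℂ
          (HermKernel.gramOperator hL (gnsKernel_isHermitian hZ) h₁ h₂))) := by
  have hT := HermKernel.isSelfAdjoint_gramOperator hL (gnsKernel_isHermitian hZ) h₁ h₂
  have hspec := HermKernel.gramOperator_spec hL (gnsKernel_isHermitian hZ) h₁ h₂
  set T := HermKernel.gramOperator hL (gnsKernel_isHermitian hZ) h₁ h₂
  by_contra! hcon
  have hs : ∀ t : ℝ, (t : ℂ) ∉ resolventSet ℂ T → t ∈ spectrum ℝ T := fun t ht =>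
    (spectrum.algebraMap_mem_iff ℂ).mp ht
  obtain ⟨e, x, he, hx, hxP, hBe⟩ := exists_orthonormal_localized_seq hT fun ε hε => by
    obtain ⟨t, ht, hts⟩ := (hcon ε hε).1
    exact ⟨t, ht, hs t hts⟩
  obtain ⟨e', x', he', hx', hxN, hBe'⟩ := exists_orthonormal_localized_seq_of_neg hT
    fun ε hε => by
      obtain ⟨t, ht, hts⟩ := (hcon ε hε).2
      exact ⟨t, ht, hs t hts⟩
  obtain ⟨J, hJ, hJ2, hJP, hJN, hBJB, hinv⟩ := exists_symmetry_of_isSelfAdjoint hT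
  set B := cfc (fun t : ℝ => √|t|) T with hB
  have hBadj : ContinuousLinearMap.adjoint B = B :=
    ContinuousLinearMap.isSelfAdjoint_iff'.mp (cfc_predicate _ T)
  obtain ⟨B', hB'form, hB'range, hB'⟩ := exists_transvection_not_dominated hJ he he'
    (fun n => by rw [← hxP]; exact hJP _) (fun n => by rw [← hxN]; exact hJN _) hx hx'
    (by rwa [hBadj]) (by rwa [hBadj])
  have hd := HermKernel.denseRange_toSpace hL
  -- Equal orthogonal complements mean equal range closures, so `J` restricts to the closed range of
  -- `C` as a fundamental symmetry. This applies to both `B` and `B'`.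
  have key : ∀ C : HermKernel.Space hL →L[ℂ] HermKernel.Space hL,
      (∀ u v, inner ℂ (C u) (J (C v)) = inner ℂ (B u) (J (B v))) →
      (LinearMap.range (C : HermKernel.Space hL →ₗ[ℂ] HermKernel.Space hL))ᗮ =
        (LinearMap.range (B : HermKernel.Space hL →ₗ[ℂ] HermKernel.Space hL))ᗮ →
      ∃ G : GNSData Z, ∀ f, ‖G.vec (starSum A f)‖ = ‖C (HermKernel.toSpace hL f)‖ := by
    intro C hC hCr
    refine exists_gnsData_of_symmetry hJ hJ2
      ((C : HermKernel.Space hL →ₗ[ℂ] HermKernel.Space hL) ∘ₗ HermKernel.toSpace hL) ?_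
      fun f g => ?_
    · rw [← Submodule.orthogonal_orthogonal_eq_closure, orthogonal_range_comp_of_denseRange C hd,
        hCr, Submodule.orthogonal_orthogonal_eq_closure]
      exact hinv
    · rw [hspec, ← hBJB]
      exact hC _ _
  obtain ⟨G₁, hG₁⟩ := key B (fun _ _ => rfl) rfl
  obtain ⟨G₂, hG₂⟩ := key B' hB'form hB'range
  obtain ⟨C, hC⟩ := (H G₁ G₂).exists_norm_vec_le
  refine hB' ⟨C, fun u => ?_⟩
  refine hd.induction_on u (isClosed_le (by fun_prop) (by fun_prop)) fun f => ?_
  rw [← hG₁, ← hG₂]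
  exact hC _

end GNSNonuniqueness

theorem mainTheorem9 {A : Type u} [Ring A] [StarRing A] [Algebra ℂ A] [StarModule ℂ A]
    (Z : A →ₗ[ℂ] ℂ) (hZ : IsHermitianFunctional Z) (hZ1 : Z 1 = 1)
    (hGNS : Nonempty (GNSData Z)) :
    (∀ G₁ G₂ : GNSData Z, G₁.UnitarilyEquivalent G₂) ↔
      ∀ (L : A → A → ℂ) (hL : HermKernel.IsPosDef L)
        (h₁ : HermKernel.KernelLE (-L) (gnsKernel Z)) (h₂ : HermKernel.KernelLE (gnsKernel Z) L),
        ∃ ε : ℝ, 0 < ε ∧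
          ((∀ t ∈ Set.Ioo (0 : ℝ) ε, (t : ℂ) ∈ resolventSet ℂ
              (HermKernel.gramOperator hL (gnsKernel_isHermitian hZ) h₁ h₂)) ∨
            (∀ t ∈ Set.Ioo (-ε) (0 : ℝ), (t : ℂ) ∈ resolventSet ℂ
              (HermKernel.gramOperator hL (gnsKernel_isHermitian hZ) h₁ h₂))) := by
  exact ⟨fun H _ hL h₁ h₂ => exists_gap_of_unitarilyEquivalent hZ H hL h₁ h₂,
    fun H G₁ G₂ => unitarilyEquivalent_of_gap hZ H G₁ G₂⟩
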